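/- Let $q,t$ be indeterminates, $M=(1-t)(1-q)$, and let $\Lambda$ be the algebra of symmetric functions in the infinite alphabet $X=x_1+x_2+\cdots$ with coefficients in $\mathbb{Q}(q,t)$. For an expression $E$ put $\Omega[E]=\exp\big(\sum_{k\ge 1}p_k[E]/k\big)$, and for $F\in\Lambda$ let $F[E]$ denote plethystic substitution. In particular $p_k[X+\sum_i M/z_i]=p_k[X]+\sum_i(1-t^k)(1-q^k)z_i^{-k}$, $\;\Omega[-zX]=\sum_{i\ge 0}(-z)^ie_i[X]$, and $\Omega[-uM]=\frac{(1-u)(1-qtu)}{(1-tu)(1-qu)}$ expanded in powers of $u$. Let $D_0$ be the operator on $\Lambda$ given by $D_0F[X]=F[X+\tfrac{M}{z}]\sum_{i\ge0}(-z)^ie_i[X]\,\big|_{z^0}$, and let $\underline{e}_1$ be multiplication by $e_1$. For co-prime integers $m,n\ge 1$ define $\mathrm{Split}(m,n)=(a,b)+(c,d)$ as follows: if $m,n>1$, then $(a,b)$ is the unique pair of integers with $1\le a\le m-1$, $1\le b\le n-1$, $mb+1=na$, and $(c,d)=(m,n)-(a,b)$; furthermore $\mathrm{Split}(1,n)=(1,n-1)+(0,1)$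 and $\mathrm{Split}(m,1)=(1,0)+(m-1,1)$. Define operators $Q_{m,n}$ on $\Lambda$ recursively by $Q_{1,0}=D_0$, $Q_{0,1}=-\underline{e}_1$ and $$Q_{m,n}=\tfrac1M[Q_{c,d},Q_{a,b}]=\tfrac1M\big(Q_{c,d}Q_{a,b}-Q_{a,b}Q_{c,d}\big),\qquad \mathrm{Split}(m,n)=(a,b)+(c,d).$$ For integers $m,n\ge1$ define the Negut operator $\mathbf N_{m,n}$ on $\Lambda$ by $$\mathbf N_{m,n}F[X]=F\Big[X+\sum_{i=1}^m\tfrac{M}{z_i}\Big]\prod_{i=1}^m\Omega[-z_iX]\prod_{i=1}^m\frac1{z_i^{e_i(m,n)}}\prod_{i=1}^{m-1}\frac1{1-qt\,z_i/z_{i+1}}\prod_{1\le i<j\le m}\Omega\big[-\tfrac{z_i}{z_j}M\big]\;\Big|_{z_1^0z_2^0\cdots z_m^0},$$ where $e_i(m,n)=\lfloor i\tfrac nm\rfloor-\lfloor (i-1)\tfrac nm\rfloor$, the factors $1/(1-qt\,z_i/z_{i+1})$ and $\Omega[-\tfrac{z_i}{z_j}M]$ ($i<j$) are expanded in non-negative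 powers of $z_i/z_{i+1}$ and $z_i/z_j$ respectively, and $|_{z_1^0\cdots z_m^0}$ takes the constant term in $z_1,\dots,z_m$. **Theorem.** For every pair of co-prime positive integers $(m,n)$ with $m\le 4$, $$Q_{m,n}=\mathbf N_{m,n}$$ as operators on $\Lambda$, that is, $Q_{m,n}F=\mathbf N_{m,n}F$ for every $F\in\Lambda$. -/

import Mathlib

noncomputable section

namespace SymFun

open Finset

section Operators

variable {K : Type*} [Field K]

/-- The algebra `Λ` of symmetric functions of an infinite alphabet `X` with coefficients in a field
`K` of characteristic zero: the polynomial algebra on the power sums `p_1, p_2, p_3, …`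
(the power sums are algebraically independent and generate `Λ`). -/
abbrev Sym (K : Type*) [Field K] : Type _ := MvPolynomial ℕ+ K

/-- The power sum `p_k = p_k[X]`. -/
def p (k : ℕ+) : Sym K := MvPolynomial.X k

/-- The plethystic exponential `Ω[E] = exp (∑_{k ≥ 1} p_k[E] / k)`, for an expression `E` such that
`p_k[E] = E_k u^k`, as a power series in the variable `u`. -/
def Omega [CharZero K] (E : ℕ+ → Sym K) : PowerSeries (Sym K) :=
  (PowerSeries.exp (Sym K)).subst
    (PowerSeries.mk fun k : ℕ => if h : 0 < k then (k : ℚ)⁻¹ • E (k.toPNat h) else 0)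

/-- `Ω[-uX]`, as a power series in `u`. -/
def OmegaNegX [CharZero K] : PowerSeries (Sym K) := Omega fun k => -p k

/-- The elementary symmetric function `e_i = e_i[X]`, through its generating function
`∑_i e_i u^i = exp (∑_{k ≥ 1} (-1)^(k-1) p_k u^k / k)`. -/
def e [CharZero K] (i : ℕ) : Sym K :=
  PowerSeries.coeff i (Omega fun k : ℕ+ => (-1) ^ ((k : ℕ) - 1) * p k)

/-- `p_k[M] = (1 - t^k) (1 - q^k)`, where `M = (1 - t) (1 - q)`. -/
def pM (q t : K) (k : ℕ+) : K := (1 - t ^ (k : ℕ)) * (1 - q ^ (k : ℕ))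

/-- `Ω[-uM]`, as a power series in `u`. -/
def OmegaNegM [CharZero K] (q t : K) : PowerSeries (Sym K) := Omega fun k => -MvPolynomial.C (pM q t k)

/-- The plethystic substitution `F[X] ↦ F[X + E]`, where `E` is given by the sequence
`k ↦ p_k[E]` of (multivariate Laurent) series over `Λ`: it is the ring homomorphism which is the
identity on scalars in `K` and maps `p_k` to `p_k + p_k[E]`. -/
def shift {Γ : Type*} [AddCommMonoid Γ] [PartialOrder Γ] [IsOrderedCancelAddMonoid Γ]
    (E : ℕ+ → HahnSeries Γ (Sym K)) : Sym K →+* HahnSeries Γ (Sym K) :=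
  MvPolynomial.eval₂Hom (HahnSeries.C.comp MvPolynomial.C) fun k => HahnSeries.C (p k) + E k

theorem shift_smul {Γ : Type*} [AddCommMonoid Γ] [PartialOrder Γ] [IsOrderedCancelAddMonoid Γ]
    (E : ℕ+ → HahnSeries Γ (Sym K)) (c : K) (F : Sym K) :
    shift E (c • F) = HahnSeries.C (MvPolynomial.C c) * shift E F := by
  rw [MvPolynomial.smul_eq_C_mul, map_mul]
  simp [shift]

/-- The operator `D_k`, with `D_k F[X] = F[X + M/z] ∑_{i ≥ 0} (-z)^i e_i[X] |_{z^k}`; the right-hand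
side is a Laurent series in `z` over `Λ`, and `|_{z^k}` takes the coefficient of `z^k`. -/
def D [CharZero K] (q t : K) (k : ℤ) : Module.End K (Sym K) where
  toFun F :=
    ((shift (fun j : ℕ+ => (HahnSeries.single (-(j : ℤ)) (MvPolynomial.C (pM q t j)) :
          LaurentSeries (Sym K))) F) *
      HahnSeries.ofPowerSeries ℤ (Sym K)
        (PowerSeries.mk fun i => (-1) ^ i * e i)).coeff k
  map_add' F G := by simp [add_mul]
  map_smul' c F := by
    rw [shift_smul, mul_assoc, HahnSeries.C_mul_eq_smul, HahnSeries.coeff_smul,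
      smul_eq_mul, RingHom.id_apply, MvPolynomial.smul_eq_C_mul]

/-- `underline G`: the operator of multiplication by the symmetric function `G`. -/
def mulBy (G : Sym K) : Module.End K (Sym K) := LinearMap.mulLeft K G

theorem exists_split {m n : ℕ} (hm : 1 < m) (hn : 1 < n) (h : m.Coprime n) :
    ∃ r : ℕ × ℕ, (1 ≤ r.1 ∧ r.1 ≤ m - 1) ∧ (1 ≤ r.2 ∧ r.2 ≤ n - 1) ∧ m * r.2 + 1 = n * r.1 := by
  obtain ⟨a, ham, ha⟩ := Nat.exists_mul_mod_eq_one_of_coprime h.symm hm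
  have key := Nat.div_add_mod (n * a) m
  rw [ha] at key
  have ha1 : 1 ≤ a := by
    rcases Nat.eq_zero_or_pos a with h0 | h0
    · simp [h0] at key
    · exact h0
  refine ⟨(a, n * a / m), ⟨ha1, Nat.le_sub_one_of_lt ham⟩, ⟨?_, ?_⟩, key⟩
  · by_contra hb
    change ¬ 1 ≤ n * a / m at hb
    have hb0 : n * a / m = 0 := Nat.lt_one_iff.mp (not_le.mp hb)
    rw [hb0] at key
    have : n ≤ n * a := Nat.le_mul_of_pos_right n ha1
    omega
  · have hlt : n * a / m < n := by
      rw [Nat.div_lt_iff_lt_mul (by omega)]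
      exact Nat.mul_lt_mul_of_pos_left ham (by omega)
    show n * a / m ≤ n - 1
    omega

open Classical in
/-- The lattice point `(a, b)` of `Split (m, n) = (a, b) + (c, d)`, for co-prime `m, n ≥ 1`.
For `m, n > 1` it is the unique pair with `1 ≤ a ≤ m - 1`, `1 ≤ b ≤ n - 1` and `m b + 1 = n a`;
moreover `Split (1, n) = (1, n - 1) + (0, 1)` and `Split (m, 1) = (1, 0) + (m - 1, 1)`.
The last branch is never reached for co-prime `m, n ≥ 1`. -/
def split (m n : ℕ) : ℕ × ℕ :=
  if m = 1 then (1, n - 1)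
  else if n = 1 then (1, 0)
  else if h : ∃ r : ℕ × ℕ,
      (1 ≤ r.1 ∧ r.1 ≤ m - 1) ∧ (1 ≤ r.2 ∧ r.2 ≤ n - 1) ∧ m * r.2 + 1 = n * r.1 then h.choose
  else (0, 0)

theorem split_lt {m n : ℕ} (h : 1 ≤ m ∧ 1 ≤ n ∧ m.Coprime n) :
    (split m n).1 + (split m n).2 < m + n ∧
      (m - (split m n).1) + (n - (split m n).2) < m + n := by
  obtain ⟨hm, hn, hc⟩ := h
  unfold split
  split_ifs with h1 h2 h3
  · constructor <;> simp <;> omega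
  · constructor <;> simp <;> omega
  · have := h3.choose_spec
    constructor <;> omega
  · exact absurd (exists_split (by omega) (by omega) hc) h3

/-- The operators `Q_{m,n}` for co-prime `(m, n)`: `Q_{m,n} = (1/M) [Q_{c,d}, Q_{a,b}]` if
`m, n ≥ 1` and `Split (m, n) = (a, b) + (c, d)`, with base cases `Q_{1,0} = D_0` and
`Q_{0,1} = -underline e_1`. (Junk value `0` for other pairs, which the recursion never meets when
it starts from a co-prime pair.) -/
def Q [CharZero K] (q t : K) (m n : ℕ) : Module.End K (Sym K) :=
  if _h : 1 ≤ m ∧ 1 ≤ n ∧ m.Coprime n then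
    ((1 - t) * (1 - q))⁻¹ •
      (Q q t (m - (split m n).1) (n - (split m n).2) * Q q t (split m n).1 (split m n).2 -
        Q q t (split m n).1 (split m n).2 * Q q t (m - (split m n).1) (n - (split m n).2))
  else if m = 1 ∧ n = 0 then D q t 0
  else if m = 0 ∧ n = 1 then -mulBy (e 1)
  else 0
termination_by m + n
decreasing_by
  all_goals first
    | exact (split_lt _h).1
    | exact (split_lt _h).2

/-- The ring of formal series in `z_1, …, z_m` over `Λ`, with integer exponents, whose support is
well-ordered for the lexicographic order on exponent vectors. In this ring `z_i` for all `i` and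
`z_i / z_j` for all `i < j` are infinitesimal, so that power series in them make sense. -/
abbrev Series (K : Type*) [Field K] (m : ℕ) : Type _ := HahnSeries (Lex (Fin m → ℤ)) (Sym K)

/-- The monomial `z^a = ∏_i z_i^{a_i}`. -/
def mono {m : ℕ} (a : Fin m → ℤ) : Series K m := HahnSeries.single (toLex a) 1

/-- The monomial `z_i / z_j`. -/
def ratio {m : ℕ} (i j : Fin m) : Series K m := mono (Pi.single i 1 - Pi.single j 1)

/-- The series `f(x) = ∑_n f_n x^n`, for a power series `f` over `Λ` and an infinitesimal `x`. -/
def evalAt {m : ℕ} (f : PowerSeries (Sym K)) (x : Series K m) : Series K m :=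
  PowerSeries.heval x f

/-- The series whose constant term in `z_1, …, z_m` is `N_{m,n} F[X]`:
`F[X + ∑_i M/z_i] ∏_i Ω[-z_i X] ∏_i z_i^{-e_i(m,n)} ∏_{i<m} 1/(1 - q t z_i/z_{i+1})
∏_{i<j} Ω[-M z_i/z_j]`, where `e_i(m,n) = ⌊i n/m⌋ - ⌊(i-1) n/m⌋` for `1 ≤ i ≤ m`.
Here `1/(1 - q t u)` is the geometric series `∑_r (q t)^r u^r`. (The indices `i : Fin m` start
at `0`, so that `i` below corresponds to the subscript `i + 1`.) -/
def negutSeries [CharZero K] (q t : K) (m n : ℕ) (F : Sym K) : Series K m :=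
  shift (fun k : ℕ+ => ∑ i : Fin m,
      HahnSeries.C (MvPolynomial.C (pM q t k)) * mono (Pi.single i (-(k : ℤ)))) F *
    (∏ i : Fin m, evalAt OmegaNegX (mono (Pi.single i 1))) *
    mono (fun i : Fin m => -((((i : ℕ) + 1) * n / m : ℕ) - ((i : ℕ) * n / m : ℕ) : ℤ)) *
    (∏ x : Fin m × Fin m with (x.1 : ℕ) + 1 = x.2,
      evalAt (PowerSeries.mk fun r => MvPolynomial.C ((q * t) ^ r)) (ratio x.1 x.2)) *
    (∏ x : Fin m × Fin m with x.1 < x.2, evalAt (OmegaNegM q t) (ratio x.1 x.2))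

/-- The Negut operator `N_{m,n}`: the constant term of `negutSeries`. -/
def N [CharZero K] (q t : K) (m n : ℕ) : Module.End K (Sym K) where
  toFun F := (negutSeries q t m n F).coeff 0
  map_add' F G := by simp [negutSeries, add_mul]
  map_smul' c F := by
    simp only [negutSeries]
    rw [shift_smul]
    simp only [mul_assoc]
    rw [HahnSeries.C_mul_eq_smul, HahnSeries.coeff_smul, smul_eq_mul, RingHom.id_apply,
      MvPolynomial.smul_eq_C_mul]

end Operators

/-- The field `ℚ(q, t)` of rational functions in two indeterminates. -/
abbrev Qqt : Type := FractionRing (MvPolynomial (Fin 2) ℚ)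

/-- The indeterminate `q`. -/
def qVar : Qqt := algebraMap (MvPolynomial (Fin 2) ℚ) Qqt (MvPolynomial.X 0)

/-- The indeterminate `t`. -/
def tVar : Qqt := algebraMap (MvPolynomial (Fin 2) ℚ) Qqt (MvPolynomial.X 1)

end SymFun

end

/-! For `m = 1` both sides are `D_n`: since `p_1[X + M/z] = p_1 + M/z`, the commutator of `D_k` with
multiplication by `e_1` is `M D_{k+1}` (`D_mulBy_e_one`, `Q_one_eq_D`). For `2 ≤ m ≤ 4` every `n`
coprime to `m` is `±1` modulo `m`, so one summand of `Split(m,n)` has first coordinate `1`, and `M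
Q_{m,n}` is a commutator of `Q_{m-1,n-c}` with a single `D_c`: here `c = k` for `n = mk + 1` and `c
= k + 1` for `n = mk + m - 1`. By induction on `m` the theorem becomes a commutator identity between
`D_c`, `N_{m-1,n-c}` and `N_{m,n}`.

All these operators are constant terms of `F[X + ∑ M/z_i] ∏ Ω[-z_i X] g(z) ∏_{i<j} Ω[-M z_i/z_j]`
for some kernel `g` (`kernelOp`). They compose by concatenating variables, those of the operator
acting first coming first: the substitution `X ↦ X + ∑ M/w_j` turns `Ω[-z_i X]` into `Ω[-z_i X] ∏_j
Ω[-M z_i/w_j]`, which is exactly the missing part of the interaction product (`kernelOp_kernelOp`).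
Hence both products in the commutator, and `M N_{m,n}`, are constant terms in the same `m`
variables, and only their kernels differ.

The combined kernel does not vanish, but its constant term does. The factor `F[X + ∑ M/z_i] ∏ Ω[-z_i
X]` is symmetric in the `z_i`, so any kernel antisymmetric in two variables contributes `0`
(`coeff_zero_vertexSeries_mul`). A partial fraction identity (`kernel_identity_two`,
`kernel_identity_three`, `kernel_identity_four`) writes the combined kernel, interaction included,
as a sum of terms, each antisymmetric in two adjacent variables.

Expansions need care, because `z_i/z_j` is expanded only for `i < j`. In each antisymmetric term the
factors in the ratio of the two swapped variables have cancelled down to a Laurent polynomial, and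
for every other ratio the swap preserves the order of its variables. The swap is thus a legitimate
bijection of exponents although it is not monotone; `IsReindex` expresses this. `IsIterate` does the
analogous bookkeeping for iterated series in composition. -/

noncomputable section

set_option linter.unusedSectionVars false

namespace SymFun

open Finset

/-! ### Plethystic exponentials through their differential equation -/

section PlethysticExp

open PowerSeries

/-- `f = exp (∑_{k ≥ 1} E_k u^k / k)`, expressed through the differential equation
`f' = (∑_{k ≥ 1} E_k u^(k-1)) f` and `f(0) = 1`. -/
def IsPlethysticExp {R : Type*} [CommRing R] (E : ℕ+ → R) (f : PowerSeries R) : Prop :=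
  constantCoeff f = 1 ∧ derivative R f = (PowerSeries.mk fun n => E n.succPNat) * f

namespace IsPlethysticExp

variable {R S : Type*} [CommRing R] [CommRing S] {E E' : ℕ+ → R} {f g : PowerSeries R}

theorem coeff_succ (h : IsPlethysticExp E f) (n : ℕ) :
    coeff (n + 1) f * (n + 1) =
      ∑ x ∈ antidiagonal n, E x.1.succPNat * coeff x.2 f := by
  rw [← PowerSeries.coeff_derivative, h.2, PowerSeries.coeff_mul]
  simp

/-- The differential equation gives `(n + 1) f_{n+1}` in terms of lower coefficients, and
torsion-freeness allows cancelling `n + 1`. Identities between plethystic exponentials thereby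
reduce to identities between the sequences `E`, with no manipulation of `exp`. -/
theorem unique [IsAddTorsionFree R] (hf : IsPlethysticExp E f) (hg : IsPlethysticExp E g) :
    f = g := by
  ext n
  induction n using Nat.strong_induction_on with
  | _ n ih =>
    rcases n with _ | n
    · simpa using hf.1.trans hg.1.symm
    · have key : coeff (n + 1) f * (n + 1) = coeff (n + 1) g * (n + 1) := by
        rw [hf.coeff_succ, hg.coeff_succ]
        refine Finset.sum_congr rfl fun x hx => ?_
        rw [ih x.2 (by have := mem_antidiagonal.mp hx; omega)]
      have : (n + 1) • coeff (n + 1) f = (n + 1) • coeff (n + 1) g := by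
        simpa [nsmul_eq_mul, mul_comm] using key
      exact IsAddTorsionFree.nsmul_right_injective (Nat.succ_ne_zero n) this

theorem mul (hf : IsPlethysticExp E f) (hg : IsPlethysticExp E' g) :
    IsPlethysticExp (fun k => E k + E' k) (f * g) := by
  refine ⟨by simp [hf.1, hg.1], ?_⟩
  have : (PowerSeries.mk fun n => E n.succPNat + E' n.succPNat) =
      (PowerSeries.mk fun n => E n.succPNat) + PowerSeries.mk fun n => E' n.succPNat := by
    ext; simp
  rw [Derivation.leibniz, hf.2, hg.2, this, smul_eq_mul, smul_eq_mul]
  ring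

theorem one : IsPlethysticExp (fun _ => 0) (1 : PowerSeries R) := by
  have : (PowerSeries.mk fun _ => (0 : R)) = 0 := by ext; simp
  refine ⟨by simp, ?_⟩
  rw [this, zero_mul, ← map_one (PowerSeries.C (R := R)), PowerSeries.derivative_C]

theorem prod {ι : Type*} (s : Finset ι) {E : ι → ℕ+ → R} {f : ι → PowerSeries R}
    (h : ∀ i ∈ s, IsPlethysticExp (E i) (f i)) :
    IsPlethysticExp (fun k => ∑ i ∈ s, E i k) (∏ i ∈ s, f i) := by
  classical
  induction s using Finset.induction_on with
  | empty => simpa using one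
  | insert a s ha ih =>
    simp only [Finset.prod_insert ha, Finset.sum_insert ha]
    exact (h a (by simp)).mul (ih fun i hi => h i (by simp [hi]))

theorem map (h : IsPlethysticExp E f) (φ : R →+* S) :
    IsPlethysticExp (fun k => φ (E k)) (PowerSeries.map φ f) := by
  refine ⟨by rw [← coeff_zero_eq_constantCoeff_apply, coeff_map, coeff_zero_eq_constantCoeff_apply,
    h.1, map_one], ?_⟩
  ext n
  simp only [PowerSeries.coeff_derivative, PowerSeries.coeff_mul, coeff_map, coeff_mk, ← map_mul,
    ← map_sum, ← h.coeff_succ]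
  simp

theorem rescale (h : IsPlethysticExp E f) (c : R) :
    IsPlethysticExp (fun k => c ^ (k : ℕ) * E k) (PowerSeries.rescale c f) := by
  refine ⟨by rw [← coeff_zero_eq_constantCoeff_apply, coeff_rescale,
    coeff_zero_eq_constantCoeff_apply, h.1, pow_zero, one_mul], ?_⟩
  ext n
  rw [PowerSeries.coeff_derivative, coeff_rescale, mul_assoc, h.coeff_succ, PowerSeries.coeff_mul,
    Finset.mul_sum]
  refine Finset.sum_congr rfl fun x hx => ?_
  rw [coeff_mk, coeff_rescale, ← mem_antidiagonal.mp hx]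
  simp only [Nat.succPNat_coe, Nat.succ_eq_add_one]
  ring

theorem one_sub (c : R) :
    IsPlethysticExp (fun k => -c ^ (k : ℕ)) (1 - PowerSeries.C c * PowerSeries.X) := by
  refine ⟨by simp, ?_⟩
  have h : derivative R (1 - PowerSeries.C c * PowerSeries.X) = -PowerSeries.C c := by
    rw [map_sub, Derivation.leibniz, PowerSeries.derivative_one]
    simp
  rw [h]
  ext n
  rw [mul_sub, mul_one, ← mul_assoc, map_sub]
  rcases n with _ | n
  · simp
  · rw [PowerSeries.coeff_succ_mul_X, PowerSeries.coeff_mul_C]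
    simp [pow_succ]

theorem geom (c : R) :
    IsPlethysticExp (fun k => c ^ (k : ℕ)) (PowerSeries.mk fun n => c ^ n) := by
  refine ⟨by rw [← coeff_zero_eq_constantCoeff_apply]; simp, ?_⟩
  ext n
  rw [PowerSeries.coeff_derivative, PowerSeries.coeff_mul,
    Finset.sum_congr rfl (g := fun _ => c ^ (n + 1))]
  · simp [mul_comm]
  · intro x hx
    rw [← mem_antidiagonal.mp hx]
    simp only [coeff_mk, Nat.succPNat_coe, Nat.succ_eq_add_one]
    ring

end IsPlethysticExp

variable {K : Type*} [Field K] [CharZero K]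

/-- Chain rule for `exp ∘ L` with `L = ∑ E_k u^k / k`, whose derivative is `∑ E_k u^(k-1)`. -/
theorem isPlethysticExp_Omega (E : ℕ+ → Sym K) : IsPlethysticExp E (Omega E) := by
  set L : PowerSeries (Sym K) :=
    PowerSeries.mk fun k : ℕ => if h : 0 < k then (k : ℚ)⁻¹ • E (k.toPNat h) else 0 with hL
  have hs : HasSubst L := HasSubst.of_constantCoeff_zero' (by
    rw [← coeff_zero_eq_constantCoeff_apply]; simp [hL])
  have hd : derivative (Sym K) L = PowerSeries.mk fun n => E n.succPNat := by
    ext1 n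
    rw [PowerSeries.coeff_derivative, hL, coeff_mk, coeff_mk, dif_pos n.succ_pos]
    -- The factor produced by differentiation is written as a rational scalar so that it cancels the
    -- `1/(n+1)` in `L`.
    have h1 : ((n : Sym K) + 1) = ((n + 1 : ℕ) : ℚ) • (1 : Sym K) := by
      rw [Nat.cast_smul_eq_nsmul, nsmul_one]; push_cast; rfl
    rw [h1, smul_mul_smul_comm, mul_one, inv_mul_cancel₀ (by positivity), one_smul]
    rfl
  refine ⟨?_, ?_⟩
  · have := PowerSeries.constantCoeff_subst (R := Sym K) hs (PowerSeries.exp (Sym K))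
    rw [show constantCoeff (Omega E) = MvPowerSeries.constantCoeff
      ((PowerSeries.exp (Sym K)).subst L) from rfl, this, finsum_eq_single _ 0]
    · simp
    · intro n hn
      rw [map_pow]
      have h0 : MvPowerSeries.constantCoeff L = 0 := by
        change constantCoeff L = 0
        rw [← coeff_zero_eq_constantCoeff_apply]; simp [hL]
      rw [h0, zero_pow hn, smul_zero]
  · have := PowerSeries.derivative_subst (f := PowerSeries.exp (Sym K)) hs
    rw [PowerSeries.derivative_exp, hd] at this
    rw [show Omega E = (PowerSeries.exp (Sym K)).subst L from rfl, this, mul_comm]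

/-- The substitution `u ↦ -u` in the generating function of the `e_i` multiplies the `k`-th term by
`(-1)^k`, and `(-1)^k (-1)^(k-1) = -1`. -/
theorem OmegaNegX_eq_mk : (OmegaNegX : PowerSeries (Sym K)) =
    PowerSeries.mk fun i => (-1) ^ i * e i := by
  refine (isPlethysticExp_Omega fun k => -p k).unique ?_
  have h := (isPlethysticExp_Omega (K := K)
    fun k : ℕ+ => (-1) ^ ((k : ℕ) - 1) * p k).rescale (-1)
  convert h using 1
  · funext k
    obtain ⟨n, hn⟩ : ∃ n, (k : ℕ) = n + 1 := ⟨k.natPred, by simp⟩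
    rw [hn, Nat.add_sub_cancel, ← mul_assoc, ← pow_add,
      Odd.neg_one_pow (by exact ⟨n, by ring⟩)]
    ring
  · ext1 i
    simp [e]

theorem e_one : (e 1 : Sym K) = p 1 := by
  have h := (isPlethysticExp_Omega (K := K)
    fun k : ℕ+ => (-1) ^ ((k : ℕ) - 1) * p k)
  have h1 := h.coeff_succ 0
  rw [Nat.cast_zero, zero_add, zero_add, mul_one, HasAntidiagonal.antidiagonal_zero,
    Finset.sum_singleton, coeff_zero_eq_constantCoeff_apply, h.1] at h1
  rw [e, h1]
  simp [Nat.succPNat]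

/-- `(1 - u) (1 - q t u) / ((1 - t u) (1 - q u))` as a power series in `u`. -/
def omegaM (q t : K) : PowerSeries K :=
  (1 - PowerSeries.C 1 * PowerSeries.X) * (1 - PowerSeries.C (q * t) * PowerSeries.X) *
    (PowerSeries.mk fun n => t ^ n) * PowerSeries.mk fun n => q ^ n

/-- The reason is `-p_k[M] = -1 - (qt)^k + t^k + q^k`, one term per factor. It matters later that
the coefficients are scalars, hence fixed by every plethystic shift. -/
theorem OmegaNegM_eq_map (q t : K) :
    OmegaNegM q t = PowerSeries.map MvPolynomial.C (omegaM q t) := by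
  have h := ((((IsPlethysticExp.one_sub (1 : K)).mul (.one_sub (q * t))).mul (.geom t)).mul
    (.geom q)).map (MvPolynomial.C (σ := ℕ+))
  refine (isPlethysticExp_Omega _).unique ?_
  convert h using 1
  · funext k
    rw [← map_neg, pM]
    congr 1
    ring
  · rfl

end PlethysticExp

/-! ### Hahn series under changes of exponents and iteration -/

section HahnSeriesTransport

open HahnSeries

section Evaluation

variable {Γ R : Type*} [AddCommGroup Γ] [LinearOrder Γ] [IsOrderedAddMonoid Γ] [CommRing R]

/-- As `v > 0`, the exponents `n • v` are pairwise distinct, so only one power contributes to each.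
With the next lemma this determines all coefficients, so evaluations can be compared exponent by
exponent. -/
theorem coeff_heval_single {v : Γ} (hv : 0 < v) (f : PowerSeries R) (n : ℕ) :
    (PowerSeries.heval (single v (1 : R)) f).coeff (n • v) = PowerSeries.coeff n f := by
  rcases subsingleton_or_nontrivial R with h | h
  · exact Subsingleton.elim _ _
  have ho : 0 < (single v (1 : R)).orderTop := by
    rw [orderTop_single one_ne_zero]; exact_mod_cast hv
  rw [PowerSeries.coeff_heval, finsum_eq_single _ n]
  · simp [hv]
  · intro k hk
    have : n • v ≠ k • v := fun h => hk ((nsmul_left_strictMono hv).injective h.symm)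
    simp [hv, coeff_single_of_ne this]

theorem coeff_heval_single_of_ne {v : Γ} (hv : 0 < v) (f : PowerSeries R) {a : Γ}
    (ha : ∀ n : ℕ, a ≠ n • v) :
    (PowerSeries.heval (single v (1 : R)) f).coeff a = 0 := by
  rcases subsingleton_or_nontrivial R with h | h
  · exact Subsingleton.elim _ _
  have ho : 0 < (single v (1 : R)).orderTop := by
    rw [orderTop_single one_ne_zero]; exact_mod_cast hv
  rw [PowerSeries.coeff_heval, finsum_eq_zero_of_forall_eq_zero]
  intro k
  simp [hv, coeff_single_of_ne (ha k)]

end Evaluation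

section MapRingHom

variable {Γ A B : Type*} [AddCommMonoid Γ] [PartialOrder Γ] [IsOrderedCancelAddMonoid Γ]
  [CommRing A] [CommRing B]

/-- The ring homomorphism of Hahn series which applies a ring homomorphism to the coefficients. -/
def hahnMap (φ : A →+* B) : HahnSeries Γ A →+* HahnSeries Γ B where
  toFun x := x.map φ
  map_one' := HahnSeries.map_C 1 φ |>.trans (by simp)
  map_zero' := by ext; simp
  map_add' x y := by ext; simp
  map_mul' x y := HahnSeries.map_mul (φ : A →ₙ+* B)

theorem coeff_hahnMap (φ : A →+* B) (x : HahnSeries Γ A) (a : Γ) :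
    (hahnMap φ x).coeff a = φ (x.coeff a) := rfl

theorem hahnMap_single (φ : A →+* B) (a : Γ) (r : A) :
    hahnMap φ (single a r) = single a (φ r) := by
  ext b
  rw [coeff_hahnMap, coeff_single, coeff_single]
  split_ifs <;> simp

end MapRingHom

theorem hahnMap_heval {Γ A B : Type*} [AddCommGroup Γ] [LinearOrder Γ] [IsOrderedAddMonoid Γ]
    [CommRing A] [CommRing B] (φ : A →+* B) {v : Γ} (hv : 0 < v) (f : PowerSeries A) :
    hahnMap φ (PowerSeries.heval (single v (1 : A)) f) =
      PowerSeries.heval (single v (1 : B)) (PowerSeries.map φ f) := by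
  ext a
  rw [coeff_hahnMap]
  by_cases h : ∃ n : ℕ, a = n • v
  · obtain ⟨n, rfl⟩ := h
    rw [coeff_heval_single hv, coeff_heval_single hv, PowerSeries.coeff_map]
  · push Not at h
    rw [coeff_heval_single_of_ne hv _ h, coeff_heval_single_of_ne hv _ h, map_zero]

section Reindex

variable {Γ Γ' R : Type*} [AddCommMonoid Γ] [PartialOrder Γ] [IsOrderedCancelAddMonoid Γ]
  [AddCommMonoid Γ'] [PartialOrder Γ'] [IsOrderedCancelAddMonoid Γ'] [CommRing R]
  {e : Γ ≃+ Γ'} {x x' : HahnSeries Γ R} {y y' : HahnSeries Γ' R}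

/-- The Hahn series `y` is obtained from `x` by the isomorphism `e` of exponent monoids, which need
not be monotone. -/
def IsReindex (e : Γ ≃+ Γ') (x : HahnSeries Γ R) (y : HahnSeries Γ' R) : Prop :=
  ∀ a, y.coeff (e a) = x.coeff a

namespace IsReindex

theorem add (h : IsReindex e x y) (h' : IsReindex e x' y') : IsReindex e (x + x') (y + y') :=
  fun a => by simp [h a, h' a]

theorem sub (h : IsReindex e x y) (h' : IsReindex e x' y') : IsReindex e (x - x') (y - y') :=
  fun a => by simp [h a, h' a]

/-- A coefficient of a product is a finite sum over pairs of support elements with given sum. Once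
all four series exist, only the additivity of `e` enters, never the order. -/
theorem mul (h : IsReindex e x y) (h' : IsReindex e x' y') : IsReindex e (x * x') (y * y') := by
  intro a
  rw [coeff_mul, coeff_mul]
  symm
  refine Finset.sum_bij' (fun i _ => (e i.1, e i.2)) (fun i _ => (e.symm i.1, e.symm i.2))
    ?_ ?_ ?_ ?_ ?_
  · intro i hi
    simp only [Finset.mem_antidiagonal, mem_support] at hi ⊢
    rw [h, h', ← map_add, hi.2.2]
    exact ⟨hi.1, hi.2.1, rfl⟩
  · intro i hi
    simp only [Finset.mem_antidiagonal, mem_support] at hi ⊢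
    rw [← h, ← h', ← map_add, hi.2.2, e.apply_symm_apply, e.apply_symm_apply, e.symm_apply_apply]
    exact ⟨hi.1, hi.2.1, rfl⟩
  · simp
  · simp
  · intro i _
    rw [h, h']

theorem single (a : Γ) (r : R) :
    IsReindex e (HahnSeries.single a r) (HahnSeries.single (e a) r) := by
  intro b
  classical
  rw [coeff_single, coeff_single]
  simp only [EmbeddingLike.apply_eq_iff_eq]

theorem C (r : R) : IsReindex e (HahnSeries.C r) (HahnSeries.C r) := by
  have := single (e := e) 0 r
  rwa [map_zero] at this

theorem sum {ι : Type*} (s : Finset ι) {f : ι → HahnSeries Γ R} {g : ι → HahnSeries Γ' R}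
    (h : ∀ i ∈ s, IsReindex e (f i) (g i)) : IsReindex e (∑ i ∈ s, f i) (∑ i ∈ s, g i) := by
  intro a
  simp only [coeff_sum]
  exact Finset.sum_congr rfl fun i hi => h i hi a

theorem prod {ι : Type*} (s : Finset ι) {f : ι → HahnSeries Γ R} {g : ι → HahnSeries Γ' R}
    (h : ∀ i ∈ s, IsReindex e (f i) (g i)) : IsReindex e (∏ i ∈ s, f i) (∏ i ∈ s, g i) := by
  classical
  induction s using Finset.induction_on with
  | empty => simpa using C (e := e) (1 : R)
  | insert a s ha ih =>
    simp only [Finset.prod_insert ha]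
    exact (h a (by simp)).mul (ih fun i hi => h i (by simp [hi]))

theorem coeff_zero (h : IsReindex e x y) : y.coeff 0 = x.coeff 0 := by
  have := h 0
  rwa [map_zero] at this

/-- The exponent `0` is fixed by `e`, so the constant term equals its own negative. -/
theorem coeff_zero_of_neg [IsAddTorsionFree R] {e : Γ ≃+ Γ} (h : IsReindex e x (-x)) :
    x.coeff 0 = 0 := by
  have := h.coeff_zero
  rw [coeff_neg] at this
  exact self_eq_neg.mp this.symm

end IsReindex

/-- Monotonicity of `e` is replaced by positivity of the single exponent `e v`: the image monomial
must still be infinitesimal for the expansion to be the intended one. -/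
theorem IsReindex.heval {Γ Γ' R : Type*} [AddCommGroup Γ] [LinearOrder Γ] [IsOrderedAddMonoid Γ]
    [AddCommGroup Γ'] [LinearOrder Γ'] [IsOrderedAddMonoid Γ'] [CommRing R] {e : Γ ≃+ Γ'}
    {v : Γ} (hv : 0 < v) (hev : 0 < e v) (f : PowerSeries R) :
    IsReindex e (PowerSeries.heval (HahnSeries.single v (1 : R)) f)
      (PowerSeries.heval (HahnSeries.single (e v) (1 : R)) f) := by
  intro a
  by_cases h : ∃ n : ℕ, a = n • v
  · obtain ⟨n, rfl⟩ := h
    rw [map_nsmul, coeff_heval_single hv, coeff_heval_single hev]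
  · push Not at h
    rw [coeff_heval_single_of_ne hv _ h, coeff_heval_single_of_ne hev]
    intro n hn
    rw [← map_nsmul] at hn
    exact h n (e.injective hn)

end Reindex

section Iterate

variable {Γ₁ Γ₂ Γ R : Type*} [AddCommMonoid Γ₁] [PartialOrder Γ₁] [IsOrderedCancelAddMonoid Γ₁]
  [AddCommMonoid Γ₂] [PartialOrder Γ₂] [IsOrderedCancelAddMonoid Γ₂]
  [AddCommMonoid Γ] [PartialOrder Γ] [IsOrderedCancelAddMonoid Γ] [CommRing R]
  {e : Γ₁ × Γ₂ ≃+ Γ} {x x' : HahnSeries Γ₁ (HahnSeries Γ₂ R)} {y y' : HahnSeries Γ R}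

/-- The iterated Hahn series `x` and the Hahn series `y` agree, exponents being identified
by `e`. -/
def IsIterate (e : Γ₁ × Γ₂ ≃+ Γ) (x : HahnSeries Γ₁ (HahnSeries Γ₂ R)) (y : HahnSeries Γ R) :
    Prop :=
  ∀ k l, y.coeff (e (k, l)) = (x.coeff k).coeff l

namespace IsIterate

theorem add (h : IsIterate e x y) (h' : IsIterate e x' y') : IsIterate e (x + x') (y + y') :=
  fun k l => by simp [h k l, h' k l]

theorem mul (h : IsIterate e x y) (h' : IsIterate e x' y') : IsIterate e (x * x') (y * y') := by
  intro k l
  rw [coeff_mul, coeff_mul, coeff_sum]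
  simp only [coeff_mul]
  rw [Finset.sum_sigma']
  symm
  refine Finset.sum_bij' (fun i _ => (e (i.1.1, i.2.1), e (i.1.2, i.2.2)))
    (fun i _ => ⟨((e.symm i.1).1, (e.symm i.2).1), ((e.symm i.1).2, (e.symm i.2).2)⟩)
    ?_ ?_ ?_ ?_ ?_
  · intro i hi
    simp only [Finset.mem_sigma, Finset.mem_antidiagonal, mem_support] at hi ⊢
    obtain ⟨⟨_, _, h3⟩, h4, h5, h6⟩ := hi
    refine ⟨by rwa [h], by rwa [h'], ?_⟩
    rw [← map_add, Prod.mk_add_mk, h3, h6]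
  · intro i hi
    simp only [Finset.mem_antidiagonal, mem_support] at hi
    obtain ⟨h1, h2, h3⟩ := hi
    rw [← e.apply_symm_apply i.1, ← Prod.mk.eta (p := e.symm i.1), h] at h1
    rw [← e.apply_symm_apply i.2, ← Prod.mk.eta (p := e.symm i.2), h'] at h2
    have h4 : e.symm i.1 + e.symm i.2 = (k, l) := by
      rw [← map_add, h3, e.symm_apply_apply]
    simp only [Finset.mem_sigma, Finset.mem_antidiagonal, mem_support]
    -- A nonzero inner coefficient forces the outer coefficient containing it to be nonzero, so the
    -- supports match.
    refine ⟨⟨fun h0 => h1 (by rw [h0, coeff_zero]), fun h0 => h2 (by rw [h0, coeff_zero]),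
      congrArg Prod.fst h4⟩, h1, h2, congrArg Prod.snd h4⟩
  · simp
  · simp
  · intro i _
    rw [h, h']

theorem single (a : Γ₁) (b : Γ₂) (r : R) :
    IsIterate e (HahnSeries.single a (HahnSeries.single b r)) (HahnSeries.single (e (a, b)) r) := by
  intro k l
  classical
  rw [coeff_single, coeff_single]
  simp only [EmbeddingLike.apply_eq_iff_eq, Prod.mk.injEq]
  by_cases hk : k = a
  · simp [hk, coeff_single]
  · simp [hk]

theorem C (r : R) : IsIterate e (HahnSeries.C (HahnSeries.C r)) (HahnSeries.C r) := by
  have := single (e := e) 0 0 r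
  rwa [show ((0, 0) : Γ₁ × Γ₂) = 0 from rfl, map_zero] at this

theorem sum {ι : Type*} (s : Finset ι) {f : ι → HahnSeries Γ₁ (HahnSeries Γ₂ R)}
    {g : ι → HahnSeries Γ R} (h : ∀ i ∈ s, IsIterate e (f i) (g i)) :
    IsIterate e (∑ i ∈ s, f i) (∑ i ∈ s, g i) := by
  intro k l
  simp only [coeff_sum]
  exact Finset.sum_congr rfl fun i hi => h i hi k l

theorem prod {ι : Type*} (s : Finset ι) {f : ι → HahnSeries Γ₁ (HahnSeries Γ₂ R)}
    {g : ι → HahnSeries Γ R} (h : ∀ i ∈ s, IsIterate e (f i) (g i)) :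
    IsIterate e (∏ i ∈ s, f i) (∏ i ∈ s, g i) := by
  classical
  induction s using Finset.induction_on with
  | empty => simpa using C (e := e) (1 : R)
  | insert a s ha ih =>
    simp only [Finset.prod_insert ha]
    exact (h a (by simp)).mul (ih fun i hi => h i (by simp [hi]))

theorem coeff_zero (h : IsIterate e x y) : y.coeff 0 = (x.coeff 0).coeff 0 := by
  have := h 0 0
  rwa [show ((0, 0) : Γ₁ × Γ₂) = 0 from rfl, map_zero] at this

end IsIterate

end Iterate

section IterateEvaluation

variable {Γ₁ Γ₂ Γ R : Type*} [AddCommGroup Γ₁] [LinearOrder Γ₁] [IsOrderedAddMonoid Γ₁]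
  [AddCommGroup Γ₂] [LinearOrder Γ₂] [IsOrderedAddMonoid Γ₂]
  [AddCommGroup Γ] [LinearOrder Γ] [IsOrderedAddMonoid Γ] [CommRing R]
  {e : Γ₁ × Γ₂ ≃+ Γ}

/-- This covers `f(z/w_j)` viewed as a series in the outer variable `z` with coefficients involving
the inner `1/w_j`. The inner exponent `w` may be negative; only `v` and the combined exponent must
be positive. -/
theorem IsIterate.heval_rescale {v : Γ₁} {w : Γ₂} (hv : 0 < v) (he : 0 < e (v, w))
    (f : PowerSeries R) :
    IsIterate e
      (PowerSeries.heval (HahnSeries.single v (1 : HahnSeries Γ₂ R))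
        (PowerSeries.rescale (HahnSeries.single w (1 : R)) (PowerSeries.map HahnSeries.C f)))
      (PowerSeries.heval (HahnSeries.single (e (v, w)) (1 : R)) f) := by
  intro k l
  by_cases h : ∃ n : ℕ, k = n • v
  · obtain ⟨n, rfl⟩ := h
    rw [coeff_heval_single hv, PowerSeries.coeff_rescale, PowerSeries.coeff_map, single_pow,
      HahnSeries.C_apply, single_mul_single, add_zero, one_pow, one_mul, coeff_single]
    split_ifs with hl
    · rw [hl, show (n • v, n • w) = n • (v, w) from rfl, map_nsmul, coeff_heval_single he]
    · refine coeff_heval_single_of_ne he _ fun n' hn' => ?_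
      rw [← map_nsmul] at hn'
      have h1 := e.injective hn'
      have h2 : n = n' := (nsmul_left_strictMono hv).injective (congrArg Prod.fst h1)
      exact hl (by rw [h2]; exact congrArg Prod.snd h1)
  · push Not at h
    rw [coeff_heval_single_of_ne hv _ h, HahnSeries.coeff_zero]
    refine coeff_heval_single_of_ne he _ fun n' hn' => ?_
    rw [← map_nsmul] at hn'
    exact h n' (congrArg Prod.fst (e.injective hn'))

theorem IsIterate.heval_left {v : Γ₁} (hv : 0 < v) (he : 0 < e (v, 0)) (f : PowerSeries R) :
    IsIterate e
      (PowerSeries.heval (HahnSeries.single v (1 : HahnSeries Γ₂ R))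
        (PowerSeries.map HahnSeries.C f))
      (PowerSeries.heval (HahnSeries.single (e (v, 0)) (1 : R)) f) := by
  have := IsIterate.heval_rescale hv he f
  rwa [show HahnSeries.single (0 : Γ₂) (1 : R) = 1 from rfl, PowerSeries.rescale_one] at this

theorem IsIterate.heval_right {w : Γ₂} (hw : 0 < w) (he : 0 < e (0, w)) (f : PowerSeries R) :
    IsIterate e
      (HahnSeries.C (PowerSeries.heval (HahnSeries.single w (1 : R)) f))
      (PowerSeries.heval (HahnSeries.single (e (0, w)) (1 : R)) f) := by
  intro k l
  rw [HahnSeries.C_apply, coeff_single]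
  split_ifs with hk
  · subst hk
    by_cases h : ∃ n : ℕ, l = n • w
    · obtain ⟨n, rfl⟩ := h
      rw [show ((0 : Γ₁), n • w) = n • (0, w) by simp, map_nsmul, coeff_heval_single he,
        coeff_heval_single hw]
    · push Not at h
      rw [coeff_heval_single_of_ne hw _ h]
      refine coeff_heval_single_of_ne he _ fun n hn => ?_
      rw [← map_nsmul] at hn
      exact h n (congrArg Prod.snd (e.injective hn))
  · refine coeff_heval_single_of_ne he _ fun n hn => ?_
    rw [← map_nsmul] at hn
    have := congrArg Prod.fst (e.injective hn)
    exact hk (by simpa using this)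

end IterateEvaluation

end HahnSeriesTransport

/-! ### Concatenation and permutation of exponent vectors -/

section Exponents

/-- Concatenation of exponent vectors. -/
def appendAddEquiv (m₁ m₂ : ℕ) :
    Lex (Fin m₁ → ℤ) × Lex (Fin m₂ → ℤ) ≃+ Lex (Fin (m₁ + m₂) → ℤ) where
  toFun x := toLex (Fin.append (ofLex x.1) (ofLex x.2))
  invFun x := (toLex fun i => ofLex x (Fin.castAdd m₂ i), toLex fun i => ofLex x (Fin.natAdd m₁ i))
  left_inv x := Prod.ext (ofLex.injective (funext fun i => Fin.append_left _ _ i))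
    (ofLex.injective (funext fun i => Fin.append_right _ _ i))
  right_inv x := by
    apply ofLex.injective
    funext i
    refine Fin.addCases (fun i => ?_) (fun i => ?_) i <;> simp
  map_add' x y := by
    apply ofLex.injective
    funext i
    rw [ofLex_add]
    refine Fin.addCases (fun i => ?_) (fun i => ?_) i <;>
      simp only [ofLex_toLex, Pi.add_apply, Fin.append_left, Fin.append_right] <;> rfl

theorem appendAddEquiv_apply {m₁ m₂ : ℕ} (a : Fin m₁ → ℤ) (b : Fin m₂ → ℤ) :
    appendAddEquiv m₁ m₂ (toLex a, toLex b) = toLex (Fin.append a b) := rfl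

theorem append_single_zero {m₁ m₂ : ℕ} (i : Fin m₁) (c : ℤ) :
    Fin.append (Pi.single i c) (0 : Fin m₂ → ℤ) = Pi.single (Fin.castAdd m₂ i) c := by
  funext j
  refine Fin.addCases (fun j => ?_) (fun j => ?_) j
  · simp [Pi.single_apply]
  · rw [Fin.append_right, Pi.single_eq_of_ne]
    · rfl
    · simp [Fin.ext_iff]; omega

theorem append_zero_single {m₁ m₂ : ℕ} (i : Fin m₂) (c : ℤ) :
    Fin.append (0 : Fin m₁ → ℤ) (Pi.single i c) = Pi.single (Fin.natAdd m₁ i) c := by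
  funext j
  refine Fin.addCases (fun j => ?_) (fun j => ?_) j
  · rw [Fin.append_left, Pi.single_eq_of_ne]
    · rfl
    · simp [Fin.ext_iff]; omega
  · simp [Pi.single_apply]

theorem append_single_sub_single_zero {m₁ m₂ : ℕ} (i j : Fin m₁) :
    Fin.append (Pi.single i 1 - Pi.single j 1) (0 : Fin m₂ → ℤ) =
      Pi.single (Fin.castAdd m₂ i) 1 - Pi.single (Fin.castAdd m₂ j) 1 := by
  rw [← append_single_zero, ← append_single_zero]
  funext k
  refine Fin.addCases (fun k => ?_) (fun k => ?_) k <;> simp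

theorem append_zero_single_sub_single {m₁ m₂ : ℕ} (i j : Fin m₂) :
    Fin.append (0 : Fin m₁ → ℤ) (Pi.single i 1 - Pi.single j 1) =
      Pi.single (Fin.natAdd m₁ i) 1 - Pi.single (Fin.natAdd m₁ j) 1 := by
  rw [← append_zero_single, ← append_zero_single]
  funext k
  refine Fin.addCases (fun k => ?_) (fun k => ?_) k <;> simp

theorem append_single_neg_single {m₁ m₂ : ℕ} (i : Fin m₁) (j : Fin m₂) :
    Fin.append (Pi.single i (1 : ℤ)) (Pi.single j (-1)) =
      Pi.single (Fin.castAdd m₂ i) 1 - Pi.single (Fin.natAdd m₁ j) 1 := by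
  rw [← append_single_zero, ← append_zero_single]
  funext k
  refine Fin.addCases (fun k => ?_) (fun k => ?_) k <;>
    simp [Pi.single_neg]

theorem toLex_single_pos {m : ℕ} (i : Fin m) : 0 < toLex (Pi.single i 1 : Fin m → ℤ) := by
  refine ⟨i, fun j hj => ?_, ?_⟩
  · change (0 : ℤ) = (Pi.single i 1 : Fin m → ℤ) j
    rw [Pi.single_eq_of_ne (ne_of_lt hj)]
  · change (0 : ℤ) < (Pi.single i 1 : Fin m → ℤ) i
    simp

theorem toLex_ratio_pos {m : ℕ} {i j : Fin m} (h : i < j) :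
    0 < toLex (Pi.single i 1 - Pi.single j 1 : Fin m → ℤ) := by
  refine ⟨i, fun k hk => ?_, ?_⟩
  · change (0 : ℤ) = (Pi.single i 1 : Fin m → ℤ) k - (Pi.single j 1 : Fin m → ℤ) k
    rw [Pi.single_eq_of_ne (ne_of_lt hk), Pi.single_eq_of_ne (ne_of_lt (lt_trans hk h)), sub_zero]
  · change (0 : ℤ) < (Pi.single i 1 : Fin m → ℤ) i - (Pi.single j 1 : Fin m → ℤ) i
    rw [Pi.single_eq_same, Pi.single_eq_of_ne h.ne]
    norm_num

/-- Permutation of the entries of exponent vectors. -/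
def permAddEquiv {m : ℕ} (σ : Equiv.Perm (Fin m)) : Lex (Fin m → ℤ) ≃+ Lex (Fin m → ℤ) where
  toFun x := toLex fun i => ofLex x (σ.symm i)
  invFun x := toLex fun i => ofLex x (σ i)
  left_inv x := ofLex.injective (funext fun i => congrArg (ofLex x) (σ.symm_apply_apply i))
  right_inv x := ofLex.injective (funext fun i => congrArg (ofLex x) (σ.apply_symm_apply i))
  map_add' _ _ := rfl

theorem permAddEquiv_single {m : ℕ} (σ : Equiv.Perm (Fin m)) (i : Fin m) (c : ℤ) :
    permAddEquiv σ (toLex (Pi.single i c)) = toLex (Pi.single (σ i) c) := by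
  apply ofLex.injective
  funext j
  change (Pi.single i c : Fin m → ℤ) (σ.symm j) = (Pi.single (σ i) c : Fin m → ℤ) j
  simp only [Pi.single_apply, Equiv.symm_apply_eq]

theorem permAddEquiv_ratio {m : ℕ} (σ : Equiv.Perm (Fin m)) (i j : Fin m) :
    permAddEquiv σ (toLex (Pi.single i 1 - Pi.single j 1)) =
      toLex (Pi.single (σ i) 1 - Pi.single (σ j) 1) := by
  rw [toLex_sub, map_sub, permAddEquiv_single, permAddEquiv_single, toLex_sub]

end Exponents

/-- Pairs `i < j` lie in the first block, across the blocks, or in the second block. In a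
composition the outer two products are the interactions of the two operators and the middle one
arises from the shift. -/
theorem prod_lt_append {M : Type*} [CommMonoid M] {m₁ m₂ : ℕ}
    (f : Fin (m₁ + m₂) → Fin (m₁ + m₂) → M) :
    ∏ x : Fin (m₁ + m₂) × Fin (m₁ + m₂) with x.1 < x.2, f x.1 x.2 =
      (∏ x : Fin m₁ × Fin m₁ with x.1 < x.2, f (Fin.castAdd m₂ x.1) (Fin.castAdd m₂ x.2)) *
      (∏ i : Fin m₁, ∏ j : Fin m₂, f (Fin.castAdd m₂ i) (Fin.natAdd m₁ j)) *
      ∏ x : Fin m₂ × Fin m₂ with x.1 < x.2, f (Fin.natAdd m₁ x.1) (Fin.natAdd m₁ x.2) := by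
  simp only [Finset.prod_filter, Fintype.prod_prod_type, Fin.prod_univ_add, Finset.prod_mul_distrib]
  have h1 : ∀ (i : Fin m₁) (j : Fin m₁),
      (Fin.castAdd m₂ i < Fin.castAdd m₂ j) = (i < j) := fun i j => rfl
  have h2 : ∀ (i : Fin m₁) (j : Fin m₂),
      (Fin.castAdd m₂ i < Fin.natAdd m₁ j) = True := fun i j =>
    eq_true (Fin.lt_def.mpr (by simp; omega))
  have h3 : ∀ (i : Fin m₂) (j : Fin m₁),
      (Fin.natAdd m₁ i < Fin.castAdd m₂ j) = False := fun i j =>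
    eq_false fun h => by
      have := Fin.lt_def.mp h
      simp at this
      omega
  have h4 : ∀ (i : Fin m₂) (j : Fin m₂),
      (Fin.natAdd m₁ i < Fin.natAdd m₁ j) = (i < j) := fun i j => by simp
  simp only [h1, h2, h3, h4, if_true, if_false, Finset.prod_const_one, mul_one,
    mul_assoc]

instance {Γ R : Type*} [PartialOrder Γ] [AddCommMonoid R] [IsAddTorsionFree R] :
    IsAddTorsionFree (HahnSeries Γ R) where
  nsmul_right_injective n hn x y h := by
    ext a
    have := congrArg (fun z => HahnSeries.coeff z a) h
    simp only [HahnSeries.coeff_smul] at this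
    exact IsAddTorsionFree.nsmul_right_injective hn this

/-! ### Constant-term operators, their composition and their symmetry -/

section Kernels

variable {K : Type*} [Field K]

/-- The substitution `F[X] ↦ F[X + ∑_i M / z_i]`. -/
def shiftAll (q t : K) (m : ℕ) : Sym K →+* Series K m :=
  shift fun k : ℕ+ => ∑ i : Fin m,
    HahnSeries.C (MvPolynomial.C (pM q t k)) * mono (Pi.single i (-(k : ℤ)))

theorem shiftAll_C (q t : K) (m : ℕ) (c : K) :
    shiftAll q t m (MvPolynomial.C c) = HahnSeries.C (MvPolynomial.C c) := by
  simp [shiftAll, shift]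

theorem shiftAll_p (q t : K) (m : ℕ) (k : ℕ+) :
    shiftAll q t m (p k) = HahnSeries.C (p k) + ∑ i : Fin m,
      HahnSeries.C (MvPolynomial.C (pM q t k)) * mono (Pi.single i (-(k : ℤ))) := by
  simp [shiftAll, shift, p]

theorem mono_mul_mono {m : ℕ} (a b : Fin m → ℤ) :
    (mono a * mono b : Series K m) = mono (a + b) := by
  simp [mono]

theorem mono_zero {m : ℕ} : (mono 0 : Series K m) = 1 := rfl

theorem mono_pow {m : ℕ} (a : Fin m → ℤ) (n : ℕ) :
    (mono a ^ n : Series K m) = mono (n • a) := by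
  simp [mono]

/-- Successive shifts add up, because the `M/z_i` introduced by the first have scalar coefficients,
which the second leaves alone. Both sides are multiplicative in `F`, so generators suffice. -/
theorem isIterate_shiftAll (q t : K) (m₁ m₂ : ℕ) (F : Sym K) :
    IsIterate (appendAddEquiv m₁ m₂) (hahnMap (shiftAll q t m₂) (shiftAll q t m₁ F))
      (shiftAll q t (m₁ + m₂) F) := by
  induction F using MvPolynomial.induction_on with
  | C c =>
    rw [shiftAll_C, shiftAll_C, HahnSeries.C_apply, hahnMap_single, shiftAll_C]
    exact IsIterate.C _
  | add F G hF hG =>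
    simp only [map_add]
    exact hF.add hG
  | mul_X F k hF =>
    simp only [map_mul]
    refine hF.mul ?_
    change IsIterate _ (hahnMap (shiftAll q t m₂) (shiftAll q t m₁ (p k))) (shiftAll q t (m₁ + m₂) (p k))
    rw [shiftAll_p, shiftAll_p, map_add, HahnSeries.C_apply, hahnMap_single, shiftAll_p, map_sum,
      Fin.sum_univ_add, add_comm (∑ i : Fin m₁, _), ← add_assoc, ← HahnSeries.C_apply, map_add,
      map_sum]
    refine ((IsIterate.C _).add (IsIterate.sum _ fun i _ => ?_)).add
      (IsIterate.sum _ fun i _ => ?_)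
    · rw [map_mul]
      refine (IsIterate.C _).mul ?_
      have := IsIterate.single (e := appendAddEquiv m₁ m₂) 0 (toLex (Pi.single i (-(k : ℤ))))
        (1 : Sym K)
      rwa [← toLex_zero, appendAddEquiv_apply, append_zero_single] at this
    · rw [map_mul, HahnSeries.C_apply, hahnMap_single, shiftAll_C]
      refine (IsIterate.C _).mul ?_
      have := IsIterate.single (e := appendAddEquiv m₁ m₂) (toLex (Pi.single i (-(k : ℤ)))) 0
        (1 : Sym K)
      rw [← toLex_zero, appendAddEquiv_apply, append_single_zero] at this
      rw [mono, hahnMap_single, map_one]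
      exact this

theorem isIterate_mono_left (q t : K) {m₁ m₂ : ℕ} (a : Fin m₁ → ℤ) :
    IsIterate (appendAddEquiv m₁ m₂) (hahnMap (shiftAll q t m₂) (mono a : Series K m₁))
      (mono (Fin.append a 0)) := by
  rw [mono, hahnMap_single, map_one]
  exact IsIterate.single (e := appendAddEquiv m₁ m₂) (toLex a) (toLex 0) (1 : Sym K)

theorem isIterate_mono_right {m₁ m₂ : ℕ} (a : Fin m₂ → ℤ) :
    IsIterate (appendAddEquiv m₁ m₂) (HahnSeries.C (mono a : Series K m₂))
      (mono (Fin.append 0 a)) :=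
  IsIterate.single (e := appendAddEquiv m₁ m₂) (toLex 0) (toLex a) (1 : Sym K)

/-- The first block dominates lexicographically, so `b` is arbitrary. This makes `z_i/w_j`
infinitesimal when `z_i` is in the first block and `w_j` in the second. -/
theorem append_pos_left {m₁ m₂ : ℕ} {a : Fin m₁ → ℤ} (ha : 0 < toLex a) (b : Fin m₂ → ℤ) :
    0 < toLex (Fin.append a b) := by
  obtain ⟨i, h1, h2⟩ := ha
  refine ⟨Fin.castAdd m₂ i, fun j => ?_, ?_⟩
  · refine Fin.addCases (fun j hj => ?_) (fun j hj => ?_) j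
    · exact (h1 j hj).trans (Fin.append_left a b j).symm
    · have := Fin.lt_def.mp hj
      simp at this
      omega
  · exact lt_of_lt_of_eq h2 (Fin.append_left a b i).symm

theorem append_pos_right {m₁ m₂ : ℕ} {a : Fin m₂ → ℤ} (ha : 0 < toLex a) :
    0 < toLex (Fin.append (0 : Fin m₁ → ℤ) a) := by
  obtain ⟨i, h1, h2⟩ := ha
  refine ⟨Fin.natAdd m₁ i, fun j => ?_, ?_⟩
  · refine Fin.addCases (fun j _ => ?_) (fun j hj => ?_) j
    · exact (Fin.append_left (0 : Fin m₁ → ℤ) a j).symm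
    · exact (h1 j (by simpa using hj)).trans (Fin.append_right (0 : Fin m₁ → ℤ) a j).symm
  · exact lt_of_lt_of_eq h2 (Fin.append_right (0 : Fin m₁ → ℤ) a i).symm

theorem isIterate_evalAt_left (q t : K) {m₁ m₂ : ℕ} {a : Fin m₁ → ℤ} (ha : 0 < toLex a)
    (f : PowerSeries K) :
    IsIterate (appendAddEquiv m₁ m₂)
      (hahnMap (shiftAll q t m₂) (evalAt (PowerSeries.map MvPolynomial.C f) (mono a)))
      (evalAt (PowerSeries.map MvPolynomial.C f) (mono (Fin.append a 0))) := by
  have h : PowerSeries.map (shiftAll q t m₂) (PowerSeries.map MvPolynomial.C f) =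
      PowerSeries.map HahnSeries.C (PowerSeries.map MvPolynomial.C f) := by
    ext1 n
    simp only [PowerSeries.coeff_map, shiftAll_C]
  rw [evalAt, mono, hahnMap_heval _ ha, h]
  exact IsIterate.heval_left (e := appendAddEquiv m₁ m₂) ha (append_pos_left ha 0) _

theorem isIterate_evalAt_right {m₁ m₂ : ℕ} {a : Fin m₂ → ℤ} (ha : 0 < toLex a)
    (f : PowerSeries (Sym K)) :
    IsIterate (appendAddEquiv m₁ m₂) (HahnSeries.C (evalAt f (mono a)))
      (evalAt f (mono (Fin.append 0 a))) :=
  IsIterate.heval_right (e := appendAddEquiv m₁ m₂) ha (append_pos_right ha) _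

variable [CharZero K]

/-- This is `Ω[-u(X + ∑_j M/w_j)] = Ω[-uX] ∏_j Ω[-uM/w_j]`, the source of all interaction factors.
By uniqueness it is enough to compare power sums. -/
theorem map_shiftAll_OmegaNegX (q t : K) (m : ℕ) :
    PowerSeries.map (shiftAll q t m) OmegaNegX = PowerSeries.map HahnSeries.C OmegaNegX *
      ∏ j : Fin m, PowerSeries.rescale (mono (Pi.single j (-1)))
        (PowerSeries.map HahnSeries.C (OmegaNegM q t)) := by
  have hX := isPlethysticExp_Omega fun k => -(p k : Sym K)
  have hM := isPlethysticExp_Omega fun k => -(MvPolynomial.C (pM q t k) : Sym K)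
  refine (hX.map (shiftAll q t m)).unique ?_
  have := (hX.map (HahnSeries.C (Γ := Lex (Fin m → ℤ)))).mul
    (IsPlethysticExp.prod univ fun j _ =>
      (hM.map (HahnSeries.C (Γ := Lex (Fin m → ℤ)))).rescale (mono (Pi.single j (-1))))
  convert this using 1
  · funext k
    rw [map_neg, shiftAll_p, map_neg, neg_add, ← Finset.sum_neg_distrib]
    congr 1
    refine Finset.sum_congr rfl fun j _ => ?_
    rw [mono_pow, ← Pi.single_smul, map_neg, mul_neg, mul_comm]
    simp
  · rfl

theorem isIterate_OmegaNegX (q t : K) {m₁ m₂ : ℕ} (i : Fin m₁) :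
    IsIterate (appendAddEquiv m₁ m₂)
      (hahnMap (shiftAll q t m₂) (evalAt OmegaNegX (mono (Pi.single i 1))))
      (evalAt OmegaNegX (mono (Pi.single (Fin.castAdd m₂ i) 1)) *
        ∏ j : Fin m₂, evalAt (OmegaNegM q t) (ratio (Fin.castAdd m₂ i) (Fin.natAdd m₁ j))) := by
  rw [evalAt, mono, hahnMap_heval _ (toLex_single_pos i), map_shiftAll_OmegaNegX, map_mul, map_prod]
  refine IsIterate.mul ?_ (IsIterate.prod _ fun j _ => ?_)
  · have := IsIterate.heval_left (e := appendAddEquiv m₁ m₂) (toLex_single_pos i)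
      (append_pos_left (toLex_single_pos i) 0) (OmegaNegX : PowerSeries (Sym K))
    rwa [← toLex_zero, appendAddEquiv_apply, append_single_zero] at this
  · have := IsIterate.heval_rescale (e := appendAddEquiv m₁ m₂) (toLex_single_pos i)
      (w := toLex (Pi.single j (-1)))
      (append_pos_left (toLex_single_pos i) _) (OmegaNegM q t)
    rwa [appendAddEquiv_apply, append_single_neg_single] at this

/-- The series `F[X + ∑_i M/z_i] ∏_i Ω[-z_i X]`. -/
def vertexSeries (q t : K) (m : ℕ) (F : Sym K) : Series K m :=
  shiftAll q t m F * ∏ i : Fin m, evalAt OmegaNegX (mono (Pi.single i 1))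

/-- The product `∏_{i<j} Ω[-M z_i/z_j]`. -/
def interaction (q t : K) (m : ℕ) : Series K m :=
  ∏ x : Fin m × Fin m with x.1 < x.2, evalAt (OmegaNegM q t) (ratio x.1 x.2)

/-- The constant term of `F[X + ∑_i M/z_i] ∏_i Ω[-z_i X] g(z) ∏_{i<j} Ω[-M z_i/z_j]`. -/
def kernelOp (q t : K) {m : ℕ} (g : Series K m) (F : Sym K) : Sym K :=
  (vertexSeries q t m F * (g * interaction q t m)).coeff 0

/-- Taking the constant term in the outer variables commutes with a map of coefficients and with
multiplication by a factor free of those variables; so two successive constant terms become one. -/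
theorem IsIterate.coeff_zero_hahnMap_mul_C {Γ₁ Γ₂ Γ A R : Type*} [AddCommMonoid Γ₁]
    [PartialOrder Γ₁] [IsOrderedCancelAddMonoid Γ₁] [AddCommMonoid Γ₂] [PartialOrder Γ₂]
    [IsOrderedCancelAddMonoid Γ₂] [AddCommMonoid Γ] [PartialOrder Γ] [IsOrderedCancelAddMonoid Γ]
    [CommRing A] [CommRing R] {e : Γ₁ × Γ₂ ≃+ Γ} {φ : A →+* HahnSeries Γ₂ R}
    {x : HahnSeries Γ₁ A} {h : HahnSeries Γ₂ R} {y y' : HahnSeries Γ R}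
    (hx : IsIterate e (hahnMap φ x) y) (hh : IsIterate e (HahnSeries.C h) y') :
    (φ (x.coeff 0) * h).coeff 0 = (y * y').coeff 0 := by
  rw [(hx.mul hh).coeff_zero, HahnSeries.C_apply, HahnSeries.coeff_mul_single_zero, coeff_hahnMap]

theorem isIterate_interaction_left (q t : K) (m₁ m₂ : ℕ) :
    IsIterate (appendAddEquiv m₁ m₂) (hahnMap (shiftAll q t m₂) (interaction q t m₁))
      (∏ x : Fin m₁ × Fin m₁ with x.1 < x.2,
        evalAt (OmegaNegM q t) (ratio (Fin.castAdd m₂ x.1) (Fin.castAdd m₂ x.2))) := by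
  rw [interaction, map_prod]
  refine IsIterate.prod _ fun x hx => ?_
  have := isIterate_evalAt_left q t (m₂ := m₂)
    (toLex_ratio_pos (Finset.mem_filter.mp hx).2) (omegaM q t)
  rwa [append_single_sub_single_zero, ← OmegaNegM_eq_map] at this

theorem isIterate_interaction_right (q t : K) (m₁ m₂ : ℕ) :
    IsIterate (appendAddEquiv m₁ m₂) (HahnSeries.C (interaction q t m₂))
      (∏ x : Fin m₂ × Fin m₂ with x.1 < x.2,
        evalAt (OmegaNegM q t) (ratio (Fin.natAdd m₁ x.1) (Fin.natAdd m₁ x.2))) := by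
  rw [interaction, map_prod]
  refine IsIterate.prod _ fun x hx => ?_
  have := isIterate_evalAt_right (m₁ := m₁)
    (toLex_ratio_pos (Finset.mem_filter.mp hx).2) (OmegaNegM q t)
  rwa [append_zero_single_sub_single] at this

theorem isIterate_vertexSeries (q t : K) (m₁ m₂ : ℕ) (F : Sym K) :
    IsIterate (appendAddEquiv m₁ m₂) (hahnMap (shiftAll q t m₂) (vertexSeries q t m₁ F))
      (shiftAll q t (m₁ + m₂) F *
        ((∏ i : Fin m₁, evalAt OmegaNegX (mono (Pi.single (Fin.castAdd m₂ i) 1))) *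
        ∏ i : Fin m₁, ∏ j : Fin m₂,
          evalAt (OmegaNegM q t) (ratio (Fin.castAdd m₂ i) (Fin.natAdd m₁ j)))) := by
  rw [vertexSeries, map_mul, map_prod, ← Finset.prod_mul_distrib]
  exact (isIterate_shiftAll q t m₁ m₂ F).mul
    (IsIterate.prod _ fun i _ => isIterate_OmegaNegX q t i)

theorem isIterate_prod_OmegaNegX_right (m₁ m₂ : ℕ) :
    IsIterate (appendAddEquiv m₁ m₂)
      (HahnSeries.C (∏ j : Fin m₂, evalAt OmegaNegX (mono (Pi.single j 1))))
      (∏ j : Fin m₂, evalAt (OmegaNegX : PowerSeries (Sym K))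
        (mono (Pi.single (Fin.natAdd m₁ j) 1))) := by
  rw [map_prod]
  refine IsIterate.prod _ fun j _ => ?_
  have := isIterate_evalAt_right (m₁ := m₁) (toLex_single_pos j)
    (OmegaNegX : PowerSeries (Sym K))
  rwa [append_zero_single] at this

/-- The second shift acts on everything left by the first operator. Its effect on `∏ Ω[-z_i X]`
supplies the cross factors `Ω[-M z_i/w_j]`, which complete the two interactions to that of all `m₁ +
m₂` variables. -/
theorem kernelOp_kernelOp (q t : K) {m₁ m₂ : ℕ} {g₁ : Series K m₁} {g₂ : Series K m₂}
    {G₁ G₂ : Series K (m₁ + m₂)}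
    (h₁ : IsIterate (appendAddEquiv m₁ m₂) (hahnMap (shiftAll q t m₂) g₁) G₁)
    (h₂ : IsIterate (appendAddEquiv m₁ m₂) (HahnSeries.C g₂) G₂) (F : Sym K) :
    kernelOp q t g₂ (kernelOp q t g₁ F) = kernelOp q t (G₁ * G₂) F := by
  have hx := (isIterate_vertexSeries q t m₁ m₂ F).mul
    (h₁.mul (isIterate_interaction_left q t m₁ m₂))
  have hy := (isIterate_prod_OmegaNegX_right m₁ m₂).mul
    (h₂.mul (isIterate_interaction_right q t m₁ m₂))
  rw [← map_mul, ← map_mul] at hx hy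
  have key := hx.coeff_zero_hahnMap_mul_C hy
  have hi : interaction q t (m₁ + m₂) = _ :=
    prod_lt_append fun i j => evalAt (OmegaNegM q t) (ratio i j)
  have hX : ∏ i : Fin (m₁ + m₂), evalAt (OmegaNegX : PowerSeries (Sym K))
    (mono (Pi.single i 1)) = _ := Fin.prod_univ_add _
  have hl : kernelOp q t g₂ (kernelOp q t g₁ F) =
      (shiftAll q t m₂ ((vertexSeries q t m₁ F * (g₁ * interaction q t m₁)).coeff 0) *
        ((∏ j : Fin m₂, evalAt OmegaNegX (mono (Pi.single j 1))) *
          (g₂ * interaction q t m₂))).coeff 0 := by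
    rw [← mul_assoc (shiftAll q t m₂ _)]
    rfl
  rw [hl, key, kernelOp, vertexSeries, hi, hX]
  have aux : ∀ a b c d x y g g' : Series K (m₁ + m₂),
      a * (x * b) * (g * c) * (y * (g' * d)) = a * (x * y) * (g * g' * (c * b * d)) := by
    intros
    ring
  exact congrArg (fun z : Series K (m₁ + m₂) => z.coeff 0) (aux _ _ _ _ _ _ _ _)

theorem isReindex_shiftAll (q t : K) {m : ℕ} (σ : Equiv.Perm (Fin m)) (F : Sym K) :
    IsReindex (permAddEquiv σ) (shiftAll q t m F) (shiftAll q t m F) := by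
  induction F using MvPolynomial.induction_on with
  | C c =>
    rw [shiftAll_C]
    exact IsReindex.C _
  | add F G hF hG =>
    simp only [map_add]
    exact hF.add hG
  | mul_X F k hF =>
    simp only [map_mul]
    refine hF.mul ?_
    change IsReindex _ (shiftAll q t m (p k)) (shiftAll q t m (p k))
    have h := shiftAll_p q t m k
    have h' := h
    -- The same element is presented a second time with its sum permuted by `σ`, so that the two
    -- presentations correspond term by term.
    rw [← Equiv.sum_comp σ (fun i => HahnSeries.C (MvPolynomial.C (pM q t k)) *
      (mono (Pi.single i (-(k : ℤ))) : Series K m))] at h'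
    suffices IsReindex (permAddEquiv σ) (HahnSeries.C (p k) + ∑ i : Fin m,
        HahnSeries.C (MvPolynomial.C (pM q t k)) * mono (Pi.single i (-(k : ℤ))) : Series K m)
        (HahnSeries.C (p k) + ∑ i : Fin m,
        HahnSeries.C (MvPolynomial.C (pM q t k)) * mono (Pi.single (σ i) (-(k : ℤ)))) by
      rwa [← h, ← h'] at this
    refine (IsReindex.C _).add (IsReindex.sum _ fun i _ => (IsReindex.C _).mul ?_)
    have := IsReindex.single (e := permAddEquiv σ) (toLex (Pi.single i (-(k : ℤ)))) (1 : Sym K)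
    rwa [permAddEquiv_single] at this

theorem isReindex_evalAt_ratio {m : ℕ} (σ : Equiv.Perm (Fin m)) {i j : Fin m} (h : i < j)
    (h' : σ i < σ j) (f : PowerSeries (Sym K)) :
    IsReindex (permAddEquiv σ) (evalAt f (ratio i j)) (evalAt f (ratio (σ i) (σ j))) := by
  have := IsReindex.heval (e := permAddEquiv σ) (toLex_ratio_pos h)
    (by rw [permAddEquiv_ratio]; exact toLex_ratio_pos h') f
  rwa [permAddEquiv_ratio] at this

/-- No ratio `z_i/z_j` occurs here and every `z_i` is infinitesimal, so every permutation is
allowed. -/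
theorem isReindex_vertexSeries (q t : K) {m : ℕ} (σ : Equiv.Perm (Fin m)) (F : Sym K) :
    IsReindex (permAddEquiv σ) (vertexSeries q t m F) (vertexSeries q t m F) := by
  refine (isReindex_shiftAll q t σ F).mul ?_
  suffices IsReindex (permAddEquiv σ)
      (∏ i : Fin m, evalAt OmegaNegX (mono (Pi.single i 1)) : Series K m)
      (∏ i : Fin m, evalAt OmegaNegX (mono (Pi.single (σ i) 1))) by
    rwa [Equiv.prod_comp σ fun i => (evalAt OmegaNegX (mono (Pi.single i 1)) : Series K m)] at this
  refine IsReindex.prod _ fun i _ => ?_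
  have := IsReindex.heval (e := permAddEquiv σ) (toLex_single_pos i)
    (by rw [permAddEquiv_single]; exact toLex_single_pos _) (OmegaNegX : PowerSeries (Sym K))
  rwa [permAddEquiv_single] at this

/-- Symmetric times antisymmetric is antisymmetric. This is the only mechanism by which constant
terms are shown to vanish. -/
theorem coeff_zero_vertexSeries_mul (q t : K) {m : ℕ} {σ : Equiv.Perm (Fin m)} (F : Sym K)
    {x : Series K m} (hx : IsReindex (permAddEquiv σ) x (-x)) :
    (vertexSeries q t m F * x).coeff 0 = 0 := by
  have := (isReindex_vertexSeries q t σ F).mul hx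
  rw [mul_neg] at this
  exact this.coeff_zero_of_neg

end Kernels

/-! ### The operators `D_k`, the case of one variable, and the recursion through `split` -/

section Recursion

variable {K : Type*} [Field K] [CharZero K]

theorem N_eq_kernelOp (q t : K) (m n : ℕ) (F : Sym K) :
    N q t m n F = kernelOp q t
      (mono (fun i : Fin m => -((((i : ℕ) + 1) * n / m : ℕ) - ((i : ℕ) * n / m : ℕ) : ℤ)) *
        ∏ x : Fin m × Fin m with (x.1 : ℕ) + 1 = x.2,
          evalAt (PowerSeries.mk fun r => MvPolynomial.C ((q * t) ^ r)) (ratio x.1 x.2)) F := by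
  rw [kernelOp, ← mul_assoc, ← mul_assoc]
  rfl

/-- Integers as exponent vectors of length one. -/
def intAddEquiv : ℤ ≃+ Lex (Fin 1 → ℤ) where
  toFun k := toLex (Pi.single 0 k)
  invFun a := ofLex a 0
  left_inv k := by
    change (Pi.single 0 k : Fin 1 → ℤ) 0 = k
    simp
  right_inv a := ofLex.injective (funext fun i => by
    rw [Subsingleton.elim i 0, ofLex_toLex, Pi.single_eq_same])
  map_add' a b := by rw [Pi.single_add, toLex_add]

theorem isReindex_shift (q t : K) (F : Sym K) :
    IsReindex intAddEquiv
      (shift (fun j : ℕ+ => (HahnSeries.single (-(j : ℤ)) (MvPolynomial.C (pM q t j)) :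
        LaurentSeries (Sym K))) F) (shiftAll q t 1 F) := by
  induction F using MvPolynomial.induction_on with
  | C c =>
    rw [shiftAll_C]
    simp only [shift, MvPolynomial.coe_eval₂Hom, MvPolynomial.eval₂_C, RingHom.comp_apply]
    exact IsReindex.C _
  | add F G hF hG =>
    simp only [map_add]
    exact hF.add hG
  | mul_X F k hF =>
    simp only [map_mul]
    refine hF.mul ?_
    have h := shiftAll_p q t 1 k
    rw [p] at h
    rw [h, Fin.sum_univ_one]
    simp only [shift, MvPolynomial.coe_eval₂Hom, MvPolynomial.eval₂_X]
    refine (IsReindex.C _).add ?_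
    have := IsReindex.single (e := intAddEquiv) (-(k : ℤ)) (MvPolynomial.C (pM q t k) : Sym K)
    rw [HahnSeries.C_apply, mono, HahnSeries.single_mul_single, zero_add, mul_one]
    exact this

theorem isReindex_ofPowerSeries {R : Type*} [Field R] (f : PowerSeries (Sym R)) :
    IsReindex intAddEquiv (HahnSeries.ofPowerSeries ℤ (Sym R) f)
      (evalAt f (mono (Pi.single 0 1))) := by
  have hpos : 0 < intAddEquiv 1 := toLex_single_pos 0
  intro a
  change (PowerSeries.heval (HahnSeries.single (intAddEquiv 1) (1 : Sym R)) f).coeff _ = _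
  rcases lt_or_ge a 0 with ha | ha
  · rw [coeff_heval_single_of_ne hpos, HahnSeries.ofPowerSeries_apply,
      HahnSeries.embDomain_of_notMem_range]
    · rintro ⟨n, hn⟩
      have : (n : ℤ) = a := hn
      omega
    · intro n hn
      rw [← map_nsmul] at hn
      have := intAddEquiv.injective hn
      simp at this
      omega
  · lift a to ℕ using ha
    have h : (a : ℤ) = a • (1 : ℤ) := by simp
    rw [HahnSeries.ofPowerSeries_apply_coeff]
    nth_rw 1 [h]
    rw [map_nsmul, coeff_heval_single hpos]

theorem coeff_mul_mono_zero {m : ℕ} (x : Series K m) (a : Fin m → ℤ) :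
    (x * mono (-a)).coeff 0 = x.coeff (toLex a) := by
  have := HahnSeries.coeff_mul_single_add (r := (1 : Sym K)) (x := x) (a := toLex a)
    (b := toLex (-a))
  rwa [← toLex_add, add_neg_cancel, toLex_zero, mul_one] at this

theorem D_eq_kernelOp (q t : K) (k : ℤ) (F : Sym K) :
    D q t k F = kernelOp q t (mono fun _ : Fin 1 => -k) F := by
  have h := (isReindex_shift q t F).mul
    (isReindex_ofPowerSeries (PowerSeries.mk fun i => (-1) ^ i * (e i : Sym K)))
  rw [← OmegaNegX_eq_mk] at h
  have hi : interaction q t 1 = 1 := by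
    rw [interaction, Finset.filter_false_of_mem, Finset.prod_empty]
    intro x _
    simp [Subsingleton.elim x.1 x.2]
  have hk : (fun _ : Fin 1 => -k) = -Pi.single 0 k := by
    funext i
    rw [Subsingleton.elim i 0]
    simp
  rw [kernelOp, hi, mul_one, hk, coeff_mul_mono_zero, vertexSeries, Fin.prod_univ_one]
  refine Eq.trans ?_ (h k).symm
  rw [OmegaNegX_eq_mk]
  rfl

/-- The shift sends `e_1 = p_1` to `e_1 + M/z`, and the coefficient of `z^k` in `M/z` times a series
is `M` times its coefficient of `z^(k+1)`. -/
theorem D_mulBy_e_one (q t : K) (k : ℤ) (F : Sym K) :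
    D q t k (e 1 * F) = e 1 * D q t k F +
      MvPolynomial.C ((1 - t) * (1 - q)) * D q t (k + 1) F := by
  simp only [D, LinearMap.coe_mk, AddHom.coe_mk]
  rw [map_mul]
  have h : shift (fun j : ℕ+ => (HahnSeries.single (-(j : ℤ)) (MvPolynomial.C (pM q t j)) :
      LaurentSeries (Sym K))) (e 1) = HahnSeries.C (e 1) +
      HahnSeries.single (-1) (MvPolynomial.C ((1 - t) * (1 - q))) := by
    rw [e_one]
    simp [shift, p, pM]
  rw [h, add_mul, add_mul, mul_assoc, HahnSeries.coeff_add, HahnSeries.C_mul_eq_smul,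
    HahnSeries.coeff_smul, smul_eq_mul, mul_assoc]
  congr 1
  have := HahnSeries.coeff_single_mul_add (r := MvPolynomial.C ((1 - t) * (1 - q)))
    (x := shift (fun j : ℕ+ => (HahnSeries.single (-(j : ℤ)) (MvPolynomial.C (pM q t j)) :
      LaurentSeries (Sym K))) F * HahnSeries.ofPowerSeries ℤ (Sym K)
        (PowerSeries.mk fun i => (-1) ^ i * e i)) (a := k + 1) (b := -1)
  rwa [add_neg_cancel_right] at this

/-- `split` is defined by choice, so uniqueness is what makes it computable: two solutions have
first coordinates congruent modulo `m`, and both lie strictly between `0` and `m`. -/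
theorem split_eq {m n a b : ℕ} (ha : 1 ≤ a) (ham : a < m) (hn : 1 < n) (h : m * b + 1 = n * a) :
    split m n = (a, b) := by
  have hm : 1 < m := by omega
  have hb : 1 ≤ b := by
    rcases Nat.eq_zero_or_pos b with rfl | hb
    · have : n * a = 1 := by simpa using h.symm
      have := Nat.eq_one_of_mul_eq_one_right this
      omega
    · exact hb
  have hbn : b ≤ n - 1 := by
    by_contra hlt
    have h1 : m * n ≤ m * b := Nat.mul_le_mul_left m (by omega)
    have h2 : n * a < n * m := Nat.mul_lt_mul_of_pos_left ham (by omega)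
    have h3 := Nat.mul_comm m n
    omega
  have hex : ∃ r : ℕ × ℕ,
      (1 ≤ r.1 ∧ r.1 ≤ m - 1) ∧ (1 ≤ r.2 ∧ r.2 ≤ n - 1) ∧ m * r.2 + 1 = n * r.1 :=
    ⟨(a, b), ⟨ha, by omega⟩, ⟨hb, hbn⟩, h⟩
  rw [split, if_neg (by omega), if_neg (by omega), dif_pos hex]
  obtain ⟨⟨h1, h2⟩, _, h4⟩ := hex.choose_spec
  set r := hex.choose
  -- The defining equation is itself a Bézout relation, `-b m + a n = 1`.
  have hcop : IsCoprime (m : ℤ) n := ⟨-b, a, by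
    have : (m : ℤ) * b + 1 = n * a := by exact_mod_cast h
    linarith⟩
  have hdvd : (m : ℤ) ∣ r.1 - a := by
    refine hcop.dvd_of_dvd_mul_left ⟨r.2 - b, ?_⟩
    have e1 : (m : ℤ) * b + 1 = n * a := by exact_mod_cast h
    have e2 : (m : ℤ) * r.2 + 1 = n * r.1 := by exact_mod_cast h4
    linarith
  have hr : r.1 = a := by
    have := Int.eq_zero_of_abs_lt_dvd hdvd (by rw [abs_lt]; constructor <;> omega)
    omega
  refine Prod.ext hr ?_
  rw [hr, ← h] at h4
  change r.2 = b
  exact Nat.eq_of_mul_eq_mul_left (by omega : 0 < m) (by omega)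

theorem Q_eq (q t : K) {m n a b : ℕ} (hm : 1 ≤ m) (hn : 1 ≤ n) (h : m.Coprime n)
    (hs : split m n = (a, b)) :
    Q q t m n = ((1 - t) * (1 - q))⁻¹ •
      (Q q t (m - a) (n - b) * Q q t a b - Q q t a b * Q q t (m - a) (n - b)) := by
  rw [Q, dif_pos ⟨hm, hn, h⟩, hs]

/-- Since `Q_{0,1} = -e_1`, the recursion reads `M Q_{1,n+1} = D_n e_1 - e_1 D_n`, which is `M
D_{n+1}`. -/
theorem Q_one_eq_D {q t : K} (hM : (1 - t) * (1 - q) ≠ 0) (n : ℕ) : Q q t 1 n = D q t n := by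
  induction n with
  | zero =>
    rw [Q, dif_neg (by omega), if_pos ⟨rfl, rfl⟩]
    rfl
  | succ n ih =>
    have h0 : Q q t 0 1 = -mulBy (e 1) := by
      rw [Q, dif_neg (by omega), if_neg (by omega), if_pos ⟨rfl, rfl⟩]
    rw [Q_eq q t le_rfl (Nat.le_add_left 1 n) (Nat.coprime_one_left _) (a := 1) (b := n) (by simp [split]),
      Nat.sub_self, Nat.add_sub_cancel_left, h0, ih]
    refine LinearMap.ext fun F => ?_
    simp only [LinearMap.smul_apply, LinearMap.sub_apply, Module.End.mul_apply,
      LinearMap.neg_apply, mulBy, LinearMap.mulLeft_apply, map_neg, D_mulBy_e_one]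
    rw [inv_smul_eq_iff₀ hM, MvPolynomial.smul_eq_C_mul]
    push_cast
    ring

theorem N_one_eq_D (q t : K) (n : ℕ) : N q t 1 n = D q t n := by
  refine LinearMap.ext fun F => ?_
  rw [N_eq_kernelOp, D_eq_kernelOp, Finset.filter_false_of_mem, Finset.prod_empty, mul_one]
  · congr 2
    funext i
    rw [Subsingleton.elim i 0]
    simp
  · intro x _
    simp [Subsingleton.elim x.1 x.2]

end Recursion

/-! ### Partial fraction identities for the kernels -/

section KernelIdentities

variable {R : Type*} [CommRing R]

/-- The identity of kernels behind `[N, N'] = M N''` in two variables: `a` stands for `z₁/z₂` and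
`A` for `1/(1 - q t a)`. -/
theorem kernel_identity_two {x a q t A w : R} (hA : A * (1 - q * t * a) = 1)
    (hw : w * (1 - t * a) * (1 - q * a) = (1 - a) * (1 - q * t * a)) :
    (x * a - x - (1 - t) * (1 - q) * (x * a * A)) * w = -(x * (1 - a)) := by
  -- Over the denominator `1 - qta` the bracket on the left is `-x A (1 - ta)(1 - qa)`, which
  -- cancels the denominators of `w`.
  linear_combination (x * w * (1 - a) - x * (1 - a)) * hA - x * A * hw

/-- The identity of kernels in three variables: `a`, `b` stand for `z₁/z₂`, `z₂/z₃`, and `Aᵢⱼ`,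
`wᵢⱼ` stand for `1/(1 - q t zᵢ/zⱼ)` and `Ω[-M zᵢ/zⱼ]`. -/
theorem kernel_identity_three {x a b q t A12 A23 A13 w12 w23 w13 : R}
    (h12 : A12 * (1 - q * t * a) = 1) (h23 : A23 * (1 - q * t * b) = 1)
    (h13 : A13 * (1 - q * t * (a * b)) = 1)
    (k12 : w12 * (1 - t * a) * (1 - q * a) = (1 - a) * (1 - q * t * a))
    (k23 : w23 * (1 - t * b) * (1 - q * b) = (1 - b) * (1 - q * t * b)) :
    (x * b * A23 - x * A12 - (1 - t) * (1 - q) * (x * b * (A12 * A23))) * (w12 * w13 * w23) =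
      -(x * (1 - b) * ((A12 * w12) * (A13 * w13))
        - q * t * (x * b ^ 2 * (1 - a)) * ((A13 * w13) * (A23 * w23))) := by
  have f12 : A12 * w12 * ((1 - t * a) * (1 - q * a)) = 1 - a := by
    linear_combination A12 * k12 + (1 - a) * h12
  have f23 : A23 * w23 * ((1 - t * b) * (1 - q * b)) = 1 - b := by
    linear_combination A23 * k23 + (1 - b) * h23
  have hl : x * b * A23 - x * A12 - (1 - t) * (1 - q) * (x * b * (A12 * A23)) =
      -(A12 * A23 * x * (1 - (q + t) * b + q * t * (a * b))) := by
    linear_combination (-x * b * A23) * h12 + x * A12 * h23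
  -- The numerator is split into a multiple of `(1 - tb)(1 - qb)`, clearing all factors in `z₂/z₃`,
  -- and a multiple of `(1 - ta)(1 - qa)`, clearing those in `z₁/z₂`. The new `A13` completes `A12`,
  -- respectively `A23`, to a product symmetric in the swapped variables.
  have hB : 1 - (q + t) * b + q * t * (a * b) =
      A13 * ((1 - t * b) * (1 - q * b) - q * t * b ^ 2 * ((1 - t * a) * (1 - q * a))) := by
    linear_combination (-(1 - (q + t) * b + q * t * (a * b))) * h13
  rw [hl, hB]
  linear_combination (-x * A13 * w13 * A12 * w12) * f23 +
    (q * t * b ^ 2 * x * A13 * w13 * A23 * w23) * f12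

/-- The identity of kernels in four variables: `a`, `b`, `c` stand for `z₁/z₂`, `z₂/z₃`, `z₃/z₄`,
and `Aᵢⱼ`, `wᵢⱼ` stand for `1/(1 - q t zᵢ/zⱼ)` and `Ω[-M zᵢ/zⱼ]`. -/
theorem kernel_identity_four {x a b c q t A12 A23 A34 A13 A24 w12 w23 w34 w13 w24 w14 : R}
    (h12 : A12 * (1 - q * t * a) = 1) (h23 : A23 * (1 - q * t * b) = 1)
    (h34 : A34 * (1 - q * t * c) = 1)
    (h13 : A13 * (1 - q * t * (a * b)) = 1) (h24 : A24 * (1 - q * t * (b * c)) = 1)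
    (k12 : w12 * (1 - t * a) * (1 - q * a) = (1 - a) * (1 - q * t * a))
    (k23 : w23 * (1 - t * b) * (1 - q * b) = (1 - b) * (1 - q * t * b))
    (k34 : w34 * (1 - t * c) * (1 - q * c) = (1 - c) * (1 - q * t * c)) :
    (x * c * (A23 * A34) - x * (A12 * A23) - (1 - t) * (1 - q) * (x * c * (A12 * A23 * A34))) *
        (w12 * w13 * w14 * w23 * w24 * w34) =
      -(x * (1 - c) * ((A12 * w12) * (A23 * w23) * (A24 * w24) * w13 * w14)
        + q * t * (x * c * (a - c) * (1 - b)) *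
          ((A12 * w12) * (A13 * w13) * (A24 * w24) * (A34 * w34) * w14)
        - q * t * (x * (b * c) * (1 - a)) *
          ((A34 * w34) * (A23 * w23) * (A13 * w13) * w14 * w24)) := by
  have f12 : A12 * w12 * ((1 - t * a) * (1 - q * a)) = 1 - a := by
    linear_combination A12 * k12 + (1 - a) * h12
  have f23 : A23 * w23 * ((1 - t * b) * (1 - q * b)) = 1 - b := by
    linear_combination A23 * k23 + (1 - b) * h23
  have f34 : A34 * w34 * ((1 - t * c) * (1 - q * c)) = 1 - c := by
    linear_combination A34 * k34 + (1 - c) * h34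
  have hl : x * c * (A23 * A34) - x * (A12 * A23) -
      (1 - t) * (1 - q) * (x * c * (A12 * A23 * A34)) =
      -(A12 * A23 * A34 * x * (1 - (q + t) * c + q * t * (a * c))) := by
    linear_combination (-x * c * A23 * A34) * h12 + x * A12 * A23 * h34
  -- One summand for each adjacent pair of variables; `A24` and `A13` are the factors needed to make
  -- the remaining geometric factors symmetric under the corresponding swap.
  have hB : 1 - (q + t) * c + q * t * (a * c) =
      A24 * ((1 - t * c) * (1 - q * c)) +
      q * t * c * (a - c) * A13 * A24 * ((1 - t * b) * (1 - q * b)) -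
      q * t * (b * c) * A13 * ((1 - t * a) * (1 - q * a)) := by
    linear_combination
      (A24 * ((1 - t * c) * (1 - q * c)) - (1 - (q + t) * c + q * t * (a * c)) * A24 *
        (1 - q * t * (b * c))) * h13 +
      (-A13 * (q * t * (b * c)) * ((1 - t * a) * (1 - q * a)) -
        (1 - (q + t) * c + q * t * (a * c))) * h24
  rw [hl, hB]
  linear_combination
    (-x * A12 * w12 * A23 * w23 * A24 * w24 * w13 * w14) * f34 -
    q * t * x * c * (a - c) * A12 * w12 * A13 * w13 * A24 * w24 * A34 * w34 * w14 * f23 +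
    q * t * x * (b * c) * A34 * w34 * A23 * w23 * A13 * w13 * w14 * w24 * f12

end KernelIdentities

/-! ### Geometric and interaction factors, and their defining relations -/

section Factors

variable {K : Type*} [Field K]

/-- Scalars as series. -/
def scalar (m : ℕ) : K →+* Series K m := HahnSeries.C.comp MvPolynomial.C

/-- The variable `z_i`. -/
def zVar {m : ℕ} (i : Fin m) : Series K m := mono (Pi.single i 1)

/-- The inverse of the variable `z_i`. -/
def zInv {m : ℕ} (i : Fin m) : Series K m := mono (Pi.single i (-1))

/-- The monomial `∏_i z_i^c`. -/
def zProdPow (m : ℕ) (c : ℤ) : Series K m := mono fun _ => c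

/-- The factor `1/(1 - q t z_i/z_j)`. -/
def geomFactor (q t : K) {m : ℕ} (i j : Fin m) : Series K m :=
  evalAt (PowerSeries.mk fun r => MvPolynomial.C ((q * t) ^ r)) (ratio i j)

theorem zVar_mul_zInv {m : ℕ} (i : Fin m) : (zVar i * zInv i : Series K m) = 1 := by
  rw [zVar, zInv, mono_mul_mono, ← Pi.single_add]
  simp [mono_zero]

theorem ratio_eq {m : ℕ} (i j : Fin m) : (ratio i j : Series K m) = zVar i * zInv j := by
  rw [zVar, zInv, mono_mul_mono, ratio, sub_eq_add_neg, Pi.single_neg]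

theorem zProdPow_mul_mono {m : ℕ} (c : ℤ) (v : Fin m → ℤ) :
    (zProdPow m c * mono v : Series K m) = mono fun i => c + v i :=
  mono_mul_mono _ _

theorem evalAt_one_sub {m : ℕ} {i j : Fin m} (h : i < j) (c : K) :
    evalAt (PowerSeries.map MvPolynomial.C (1 - PowerSeries.C c * PowerSeries.X)) (ratio i j) =
      1 - scalar m c * ratio i j := by
  have ho : 0 < (ratio i j : Series K m).orderTop := by
    rw [ratio, mono, HahnSeries.orderTop_single one_ne_zero]
    exact_mod_cast toLex_ratio_pos h
  simp only [map_sub, map_one, map_mul, PowerSeries.map_C, PowerSeries.map_X, evalAt,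
    PowerSeries.heval_X _ ho, PowerSeries.heval_C, scalar, RingHom.comp_apply]
  rw [HahnSeries.C_mul_eq_smul, smul_one_mul]

theorem geomFactor_eq (q t : K) {m : ℕ} (i j : Fin m) :
    geomFactor q t i j =
      evalAt (PowerSeries.map MvPolynomial.C (PowerSeries.mk fun r => (q * t) ^ r)) (ratio i j) := by
  rw [geomFactor]
  congr 1

theorem mk_pow_mul_one_sub (c : K) :
    (PowerSeries.mk fun n => c ^ n) * (1 - PowerSeries.C c * PowerSeries.X) = 1 := by
  ext n
  rw [mul_sub, mul_one, ← mul_assoc, map_sub]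
  rcases n with _ | n
  · simp
  · rw [PowerSeries.coeff_succ_mul_X, PowerSeries.coeff_mul_C]
    simp [pow_succ]

theorem geomFactor_mul (q t : K) {m : ℕ} {i j : Fin m} (h : i < j) :
    geomFactor q t i j * (1 - scalar m q * scalar m t * ratio i j) = 1 := by
  rw [geomFactor_eq, ← map_mul (scalar m), ← evalAt_one_sub h, evalAt, evalAt, ← map_mul, ← map_mul,
    mk_pow_mul_one_sub, map_one, map_one]

variable [CharZero K]

/-- The factor `Ω[-M z_i/z_j]`. -/
def omegaFactor (q t : K) {m : ℕ} (i j : Fin m) : Series K m :=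
  evalAt (OmegaNegM q t) (ratio i j)

theorem omegaM_mul (q t : K) :
    omegaM q t * (1 - PowerSeries.C t * PowerSeries.X) * (1 - PowerSeries.C q * PowerSeries.X) =
      (1 - PowerSeries.C 1 * PowerSeries.X) * (1 - PowerSeries.C (q * t) * PowerSeries.X) := by
  have ht := mk_pow_mul_one_sub t
  have hq := mk_pow_mul_one_sub q
  rw [omegaM]
  generalize (PowerSeries.mk fun n => t ^ n) = f at *
  generalize (PowerSeries.mk fun n => q ^ n) = g at *
  linear_combination ((1 - PowerSeries.C 1 * PowerSeries.X) *
    (1 - PowerSeries.C (q * t) * PowerSeries.X)) *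
      (g * (1 - PowerSeries.C q * PowerSeries.X) * ht + hq)

/-- Evaluation at an infinitesimal ratio is a ring homomorphism, so the relation holds because it
holds for power series. With `geomFactor_mul` it supplies the hypotheses of the kernel identities.
-/
theorem omegaFactor_mul (q t : K) {m : ℕ} {i j : Fin m} (h : i < j) :
    omegaFactor q t i j * (1 - scalar m t * ratio i j) * (1 - scalar m q * ratio i j) =
      (1 - ratio i j) * (1 - scalar m q * scalar m t * ratio i j) := by
  have h1 : (1 - ratio i j : Series K m) = 1 - scalar m 1 * ratio i j := by
    rw [map_one, one_mul]
  rw [h1, ← map_mul (scalar m), ← evalAt_one_sub h, ← evalAt_one_sub h, ← evalAt_one_sub h,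
    ← evalAt_one_sub h, omegaFactor, OmegaNegM_eq_map]
  simp only [evalAt, ← map_mul, omegaM_mul]

theorem interaction_two (q t : K) : interaction q t 2 = omegaFactor q t 0 1 := by
  simp [interaction, omegaFactor, Finset.prod_filter, Fintype.prod_prod_type, Fin.prod_univ_succ]

theorem interaction_three (q t : K) : interaction q t 3 =
    omegaFactor q t 0 1 * omegaFactor q t 0 2 * omegaFactor q t 1 2 := by
  simp [interaction, omegaFactor, Finset.prod_filter, Fintype.prod_prod_type, Fin.prod_univ_succ]

theorem interaction_four (q t : K) : interaction q t 4 =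
    omegaFactor q t 0 1 * omegaFactor q t 0 2 * omegaFactor q t 0 3 * omegaFactor q t 1 2 *
      omegaFactor q t 1 3 * omegaFactor q t 2 3 := by
  simp [interaction, omegaFactor, Finset.prod_filter, Fintype.prod_prod_type, Fin.prod_univ_succ,
    mul_assoc]

end Factors

/-! ### Behaviour of the factors under swaps and concatenation -/

section FactorTransport

variable {K : Type*} [Field K]

section Reindex

variable {m : ℕ} {σ : Equiv.Perm (Fin m)} {i j i' j' : Fin m}

theorem isReindex_zVar (hi : σ i = i') :
    IsReindex (permAddEquiv σ) (zVar i : Series K m) (zVar i') := by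
  subst hi
  have := IsReindex.single (e := permAddEquiv σ) (toLex (Pi.single i 1)) (1 : Sym K)
  rwa [permAddEquiv_single] at this

theorem isReindex_zInv (hi : σ i = i') :
    IsReindex (permAddEquiv σ) (zInv i : Series K m) (zInv i') := by
  subst hi
  have := IsReindex.single (e := permAddEquiv σ) (toLex (Pi.single i (-1))) (1 : Sym K)
  rwa [permAddEquiv_single] at this

theorem isReindex_zProdPow (c : ℤ) :
    IsReindex (permAddEquiv σ) (zProdPow m c : Series K m) (zProdPow m c) :=
  IsReindex.single (e := permAddEquiv σ) (toLex fun _ => c) (1 : Sym K)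

theorem isReindex_scalar (c : K) :
    IsReindex (permAddEquiv σ) (scalar m c) (scalar m c) :=
  IsReindex.C _

theorem isReindex_geomFactor [CharZero K] (q t : K) (h : i < j) (h' : i' < j') (hi : σ i = i') (hj : σ j = j') :
    IsReindex (permAddEquiv σ) (geomFactor q t i j) (geomFactor q t i' j') := by
  subst hi hj
  exact isReindex_evalAt_ratio σ h h' _

theorem isReindex_omegaFactor [CharZero K] (q t : K) (h : i < j) (h' : i' < j') (hi : σ i = i')
    (hj : σ j = j') :
    IsReindex (permAddEquiv σ) (omegaFactor q t i j) (omegaFactor q t i' j') := by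
  subst hi hj
  exact isReindex_evalAt_ratio σ h h' _

theorem coeff_zero_vertexSeries_mul_eq_zero [CharZero K] (q t : K) (F : Sym K) {x x' : Series K m}
    (h : IsReindex (permAddEquiv σ) x x') (hx : x' = -x) :
    (vertexSeries q t m F * x).coeff 0 = 0 :=
  coeff_zero_vertexSeries_mul q t F (hx ▸ h)

end Reindex

section Iterate

variable (q t : K) {m₁ m₂ : ℕ}

theorem isIterate_zVar_left {i : Fin m₁} {i' : Fin (m₁ + m₂)} (hi : Fin.castAdd m₂ i = i') :
    IsIterate (appendAddEquiv m₁ m₂) (hahnMap (shiftAll q t m₂) (zVar i)) (zVar i') := by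
  subst hi
  have := isIterate_mono_left q t (m₂ := m₂) (Pi.single i 1)
  rwa [append_single_zero] at this

theorem isIterate_zInv_left {i : Fin m₁} {i' : Fin (m₁ + m₂)} (hi : Fin.castAdd m₂ i = i') :
    IsIterate (appendAddEquiv m₁ m₂) (hahnMap (shiftAll q t m₂) (zInv i)) (zInv i') := by
  subst hi
  have := isIterate_mono_left q t (m₂ := m₂) (Pi.single i (-1))
  rwa [append_single_zero] at this

theorem isIterate_geomFactor_left {i j : Fin m₁} {i' j' : Fin (m₁ + m₂)} (h : i < j)
    (hi : Fin.castAdd m₂ i = i') (hj : Fin.castAdd m₂ j = j') :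
    IsIterate (appendAddEquiv m₁ m₂) (hahnMap (shiftAll q t m₂) (geomFactor q t i j))
      (geomFactor q t i' j') := by
  subst hi hj
  have := isIterate_evalAt_left q t (m₂ := m₂) (toLex_ratio_pos h)
    (PowerSeries.mk fun r => (q * t) ^ r)
  rw [append_single_sub_single_zero] at this
  rw [geomFactor_eq, geomFactor_eq]
  exact this

theorem isIterate_zVar_right {i : Fin m₂} {i' : Fin (m₁ + m₂)} (hi : Fin.natAdd m₁ i = i') :
    IsIterate (appendAddEquiv m₁ m₂) (HahnSeries.C (zVar i : Series K m₂)) (zVar i') := by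
  subst hi
  have := isIterate_mono_right (K := K) (m₁ := m₁) (Pi.single i 1)
  rwa [append_zero_single] at this

theorem isIterate_zInv_right {i : Fin m₂} {i' : Fin (m₁ + m₂)} (hi : Fin.natAdd m₁ i = i') :
    IsIterate (appendAddEquiv m₁ m₂) (HahnSeries.C (zInv i : Series K m₂)) (zInv i') := by
  subst hi
  have := isIterate_mono_right (K := K) (m₁ := m₁) (Pi.single i (-1))
  rwa [append_zero_single] at this

theorem isIterate_geomFactor_right {i j : Fin m₂} {i' j' : Fin (m₁ + m₂)} (h : i < j)
    (hi : Fin.natAdd m₁ i = i') (hj : Fin.natAdd m₁ j = j') :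
    IsIterate (appendAddEquiv m₁ m₂) (HahnSeries.C (geomFactor q t i j))
      (geomFactor q t i' j') := by
  subst hi hj
  have := isIterate_evalAt_right (m₁ := m₁) (toLex_ratio_pos h)
    (PowerSeries.mk fun r => MvPolynomial.C ((q * t) ^ r))
  rwa [append_zero_single_sub_single] at this

variable [CharZero K]

/-- Composition of operators whose kernels have a common power of the product of all variables
split off. -/
theorem kernelOp_zProdPow_comp (c : ℤ) {g₁ : Series K m₁} {g₂ : Series K m₂}
    {G₁ G₂ : Series K (m₁ + m₂)}
    (h₁ : IsIterate (appendAddEquiv m₁ m₂) (hahnMap (shiftAll q t m₂) g₁) G₁)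
    (h₂ : IsIterate (appendAddEquiv m₁ m₂) (HahnSeries.C g₂) G₂) (F : Sym K) :
    kernelOp q t (zProdPow m₂ c * g₂) (kernelOp q t (zProdPow m₁ c * g₁) F) =
      kernelOp q t (zProdPow (m₁ + m₂) c * (G₁ * G₂)) F := by
  have h₁' := (isIterate_mono_left q t (m₂ := m₂) fun _ : Fin m₁ => c).mul h₁
  have h₂' := (isIterate_mono_right (K := K) (m₁ := m₁) fun _ : Fin m₂ => c).mul h₂
  rw [← map_mul] at h₁' h₂'
  -- The powers of the two blocks of variables multiply to the same power of all variables.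
  have hc : (mono (Fin.append (fun _ : Fin m₁ => c) 0) * mono (Fin.append 0 fun _ : Fin m₂ => c) :
      Series K (m₁ + m₂)) = zProdPow (m₁ + m₂) c := by
    rw [mono_mul_mono, zProdPow]
    congr 1
    funext i
    refine Fin.addCases (fun i => ?_) (fun i => ?_) i <;> simp
  refine (kernelOp_kernelOp q t h₁' h₂' F).trans ?_
  rw [← hc]
  generalize (mono (Fin.append (fun _ : Fin m₁ => c) 0) : Series K (m₁ + m₂)) = u
  generalize (mono (Fin.append 0 fun _ : Fin m₂ => c) : Series K (m₁ + m₂)) = v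
  rw [mul_mul_mul_comm]

end Iterate

theorem kernelOp_sub_eq [CharZero K] (q t : K) {m : ℕ} {gl gr g : Series K m} (c : K) {F : Sym K}
    (h : (vertexSeries q t m F * ((gl - gr - scalar m c * g) * interaction q t m)).coeff 0 = 0) :
    kernelOp q t gl F - kernelOp q t gr F = c • kernelOp q t g F := by
  have e : vertexSeries q t m F * ((gl - gr - scalar m c * g) * interaction q t m) =
      vertexSeries q t m F * (gl * interaction q t m) -
      vertexSeries q t m F * (gr * interaction q t m) -
      HahnSeries.C (MvPolynomial.C c) * (vertexSeries q t m F * (g * interaction q t m)) := by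
    rw [scalar, RingHom.comp_apply]
    generalize (HahnSeries.C (MvPolynomial.C c) : Series K m) = s
    ring
  rw [e, HahnSeries.coeff_sub, HahnSeries.coeff_sub, HahnSeries.C_mul_eq_smul,
    HahnSeries.coeff_smul, smul_eq_mul] at h
  rw [kernelOp, kernelOp, kernelOp, MvPolynomial.smul_eq_C_mul]
  exact sub_eq_zero.mp h

theorem kernelOp_sub_eq_of_eq_neg [CharZero K] (q t : K) {m : ℕ} {gl gr g x : Series K m} (c : K)
    {F : Sym K} (h : (gl - gr - scalar m c * g) * interaction q t m = -x)
    (hx : (vertexSeries q t m F * x).coeff 0 = 0) :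
    kernelOp q t gl F - kernelOp q t gr F = c • kernelOp q t g F := by
  refine kernelOp_sub_eq q t c ?_
  have e : vertexSeries q t m F * -x = -(vertexSeries q t m F * x) := by ring
  rw [h, e, HahnSeries.coeff_neg, hx, neg_zero]

theorem coeff_zero_mul_add {m : ℕ} {v x y : Series K m} (hx : (v * x).coeff 0 = 0)
    (hy : (v * y).coeff 0 = 0) : (v * (x + y)).coeff 0 = 0 := by
  have e : v * (x + y) = v * x + v * y := by ring
  rw [e, HahnSeries.coeff_add, hx, hy, add_zero]

theorem coeff_zero_mul_sub {m : ℕ} {v x y : Series K m} (hx : (v * x).coeff 0 = 0)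
    (hy : (v * y).coeff 0 = 0) : (v * (x - y)).coeff 0 = 0 := by
  have e : v * (x - y) = v * x - v * y := by ring
  rw [e, HahnSeries.coeff_sub, hx, hy, sub_zero]

end FactorTransport

/-! ### Antisymmetric kernels and the commutator identities -/

section Commutators

/-! The vanishing lemmas below say that the constant term of a series vanishes if it is antisymmetric
in two adjacent variables. The suffix `_inv` marks the image of an identity under
`z_i ↦ 1/z_{m+1-i}`. -/

variable {K : Type*} [Field K] [CharZero K] (q t : K) (c : ℤ) (F : Sym K)

theorem commutator_two :
    kernelOp q t (zProdPow 2 c * zInv 1) F - kernelOp q t (zProdPow 2 c * zInv 0) F =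
      ((1 - t) * (1 - q)) • kernelOp q t (zProdPow 2 c * (zInv 1 * geomFactor q t 0 1)) F := by
  have h01 : (0 : Fin 2) < 1 := by decide
  -- With `x = 1/z₁` the right-hand side becomes `-(1/z₁ - 1/z₂)`, antisymmetric with no expanded
  -- factor left.
  have key := kernel_identity_two (x := zInv 0) (geomFactor_mul q t h01) (omegaFactor_mul q t h01)
  have hz0 := zVar_mul_zInv (K := K) (0 : Fin 2)
  have hx : (zInv 0 * ratio 0 1 : Series K 2) = zInv 1 := by
    rw [ratio_eq]; linear_combination zInv 1 * hz0
  rw [hx] at key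
  have h : IsReindex (permAddEquiv (Equiv.swap (0 : Fin 2) 1))
      (zProdPow 2 c * (zInv 0 - zInv 1) : Series K 2) (zProdPow 2 c * (zInv 1 - zInv 0)) :=
    (isReindex_zProdPow c).mul
      ((isReindex_zInv (by decide)).sub (isReindex_zInv (by decide)))
  refine kernelOp_sub_eq_of_eq_neg q t _ ?_
    (coeff_zero_vertexSeries_mul_eq_zero q t F h (by ring))
  rw [interaction_two, map_mul, map_sub, map_sub, map_one]
  linear_combination zProdPow 2 c * key + zProdPow 2 c * hx

/-- No factor in the ratio of the two swapped variables occurs; the two factors attached to the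
first variable are exchanged, and their expansions stay valid because it precedes both. -/
theorem coeff_zero_three_swap_one_two :
    (vertexSeries q t 3 F *
      (zProdPow 3 c * ((zInv 1 - zInv 2) * (geomFactor q t 0 1 * omegaFactor q t 0 1 * (geomFactor
        q t 0 2 * omegaFactor q t 0 2))))).coeff 0 = 0 := by
  have hz0 : Equiv.swap (1 : Fin 3) 2 0 = 0 := by decide
  have hz1 : Equiv.swap (1 : Fin 3) 2 1 = 2 := by decide
  have hz2 : Equiv.swap (1 : Fin 3) 2 2 = 1 := by decide
  have l01 : (0 : Fin 3) < 1 := by decide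
  have l02 : (0 : Fin 3) < 2 := by decide
  have h : IsReindex (permAddEquiv (Equiv.swap (1 : Fin 3) 2))
      (zProdPow 3 c * ((zInv 1 - zInv 2) * (geomFactor q t 0 1 * omegaFactor q t 0 1 * (geomFactor
        q t 0 2 * omegaFactor q t 0 2))) : Series K 3)
      (zProdPow 3 c * ((zInv 2 - zInv 1) * (geomFactor q t 0 2 * omegaFactor q t 0 2 * (geomFactor
        q t 0 1 * omegaFactor q t 0 1)))) :=
    ((isReindex_zProdPow c).mul (((isReindex_zInv hz1).sub (isReindex_zInv hz2)).mul
      (((isReindex_geomFactor q t l01 l02 hz0 hz1).mul (isReindex_omegaFactor q t l01 l02 hz0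
      hz1)).mul ((isReindex_geomFactor q t l02 l01 hz0 hz2).mul (isReindex_omegaFactor q t l02 l01
      hz0 hz2)))))
  exact coeff_zero_vertexSeries_mul_eq_zero q t F h (by ring)

theorem coeff_zero_three_swap_zero_one :
    (vertexSeries q t 3 F *
      (zProdPow 3 c * (scalar 3 q * scalar 3 t * (zInv 2 * zInv 2 * (zVar 1 - zVar 0)) *
        (geomFactor q t 0 2 * omegaFactor q t 0 2 * (geomFactor q t 1 2 * omegaFactor q t 1
        2))))).coeff 0 = 0 := by
  have hz0 : Equiv.swap (0 : Fin 3) 1 0 = 1 := by decide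
  have hz1 : Equiv.swap (0 : Fin 3) 1 1 = 0 := by decide
  have hz2 : Equiv.swap (0 : Fin 3) 1 2 = 2 := by decide
  have l02 : (0 : Fin 3) < 2 := by decide
  have l12 : (1 : Fin 3) < 2 := by decide
  have h : IsReindex (permAddEquiv (Equiv.swap (0 : Fin 3) 1))
      (zProdPow 3 c * (scalar 3 q * scalar 3 t * (zInv 2 * zInv 2 * (zVar 1 - zVar 0)) *
        (geomFactor q t 0 2 * omegaFactor q t 0 2 * (geomFactor q t 1 2 * omegaFactor q t 1 2))) :
        Series K 3)
      (zProdPow 3 c * (scalar 3 q * scalar 3 t * (zInv 2 * zInv 2 * (zVar 0 - zVar 1)) *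
        (geomFactor q t 1 2 * omegaFactor q t 1 2 * (geomFactor q t 0 2 * omegaFactor q t 0 2))))
        :=
    ((isReindex_zProdPow c).mul ((((isReindex_scalar _).mul (isReindex_scalar _)).mul
      (((isReindex_zInv hz2).mul (isReindex_zInv hz2)).mul ((isReindex_zVar hz1).sub
      (isReindex_zVar hz0)))).mul (((isReindex_geomFactor q t l02 l12 hz0 hz2).mul
      (isReindex_omegaFactor q t l02 l12 hz0 hz2)).mul ((isReindex_geomFactor q t l12 l02 hz1
      hz2).mul (isReindex_omegaFactor q t l12 l02 hz1 hz2)))))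
  exact coeff_zero_vertexSeries_mul_eq_zero q t F h (by ring)

theorem coeff_zero_four_swap_two_three :
    (vertexSeries q t 4 F *
      (zProdPow 4 c * ((zInv 2 - zInv 3) * (geomFactor q t 0 1 * omegaFactor q t 0 1 * (geomFactor
        q t 1 2 * omegaFactor q t 1 2) * (geomFactor q t 1 3 * omegaFactor q t 1 3) * omegaFactor
        q t 0 2 * omegaFactor q t 0 3)))).coeff 0 = 0 := by
  have hz0 : Equiv.swap (2 : Fin 4) 3 0 = 0 := by decide
  have hz1 : Equiv.swap (2 : Fin 4) 3 1 = 1 := by decide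
  have hz2 : Equiv.swap (2 : Fin 4) 3 2 = 3 := by decide
  have hz3 : Equiv.swap (2 : Fin 4) 3 3 = 2 := by decide
  have l01 : (0 : Fin 4) < 1 := by decide
  have l02 : (0 : Fin 4) < 2 := by decide
  have l03 : (0 : Fin 4) < 3 := by decide
  have l12 : (1 : Fin 4) < 2 := by decide
  have l13 : (1 : Fin 4) < 3 := by decide
  have h : IsReindex (permAddEquiv (Equiv.swap (2 : Fin 4) 3))
      (zProdPow 4 c * ((zInv 2 - zInv 3) * (geomFactor q t 0 1 * omegaFactor q t 0 1 * (geomFactor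
        q t 1 2 * omegaFactor q t 1 2) * (geomFactor q t 1 3 * omegaFactor q t 1 3) * omegaFactor
        q t 0 2 * omegaFactor q t 0 3)) : Series K 4)
      (zProdPow 4 c * ((zInv 3 - zInv 2) * (geomFactor q t 0 1 * omegaFactor q t 0 1 * (geomFactor
        q t 1 3 * omegaFactor q t 1 3) * (geomFactor q t 1 2 * omegaFactor q t 1 2) * omegaFactor
        q t 0 3 * omegaFactor q t 0 2))) :=
    ((isReindex_zProdPow c).mul (((isReindex_zInv hz2).sub (isReindex_zInv hz3)).mul
      ((((((isReindex_geomFactor q t l01 l01 hz0 hz1).mul (isReindex_omegaFactor q t l01 l01 hz0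
      hz1)).mul ((isReindex_geomFactor q t l12 l13 hz1 hz2).mul (isReindex_omegaFactor q t l12 l13
      hz1 hz2))).mul ((isReindex_geomFactor q t l13 l12 hz1 hz3).mul (isReindex_omegaFactor q t
      l13 l12 hz1 hz3))).mul (isReindex_omegaFactor q t l02 l03 hz0 hz2)).mul
      (isReindex_omegaFactor q t l03 l02 hz0 hz3))))
  exact coeff_zero_vertexSeries_mul_eq_zero q t F h (by ring)

/-- In one-based indices `z₁z₄ - z₂z₃` is invariant under `z₂ ↔ z₃`, and so is the product of the
series factors; the sign comes from `z₃ - z₂` alone. -/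
theorem coeff_zero_four_swap_one_two :
    (vertexSeries q t 4 F *
      (zProdPow 4 c * (scalar 4 q * scalar 4 t * (zInv 3 * zInv 3 * zInv 2 * zInv 1 * (zVar 0 *
        zVar 3 - zVar 1 * zVar 2) * (zVar 2 - zVar 1)) * (geomFactor q t 0 1 * omegaFactor q t 0 1
        * (geomFactor q t 0 2 * omegaFactor q t 0 2) * (geomFactor q t 1 3 * omegaFactor q t 1 3)
        * (geomFactor q t 2 3 * omegaFactor q t 2 3) * omegaFactor q t 0 3)))).coeff 0 = 0 := by
  have hz0 : Equiv.swap (1 : Fin 4) 2 0 = 0 := by decide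
  have hz1 : Equiv.swap (1 : Fin 4) 2 1 = 2 := by decide
  have hz2 : Equiv.swap (1 : Fin 4) 2 2 = 1 := by decide
  have hz3 : Equiv.swap (1 : Fin 4) 2 3 = 3 := by decide
  have l01 : (0 : Fin 4) < 1 := by decide
  have l02 : (0 : Fin 4) < 2 := by decide
  have l03 : (0 : Fin 4) < 3 := by decide
  have l13 : (1 : Fin 4) < 3 := by decide
  have l23 : (2 : Fin 4) < 3 := by decide
  have h : IsReindex (permAddEquiv (Equiv.swap (1 : Fin 4) 2))
      (zProdPow 4 c * (scalar 4 q * scalar 4 t * (zInv 3 * zInv 3 * zInv 2 * zInv 1 * (zVar 0 *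
        zVar 3 - zVar 1 * zVar 2) * (zVar 2 - zVar 1)) * (geomFactor q t 0 1 * omegaFactor q t 0 1
        * (geomFactor q t 0 2 * omegaFactor q t 0 2) * (geomFactor q t 1 3 * omegaFactor q t 1 3)
        * (geomFactor q t 2 3 * omegaFactor q t 2 3) * omegaFactor q t 0 3)) : Series K 4)
      (zProdPow 4 c * (scalar 4 q * scalar 4 t * (zInv 3 * zInv 3 * zInv 1 * zInv 2 * (zVar 0 *
        zVar 3 - zVar 2 * zVar 1) * (zVar 1 - zVar 2)) * (geomFactor q t 0 2 * omegaFactor q t 0 2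
        * (geomFactor q t 0 1 * omegaFactor q t 0 1) * (geomFactor q t 2 3 * omegaFactor q t 2 3)
        * (geomFactor q t 1 3 * omegaFactor q t 1 3) * omegaFactor q t 0 3))) :=
    ((isReindex_zProdPow c).mul ((((isReindex_scalar _).mul (isReindex_scalar _)).mul
      ((((((isReindex_zInv hz3).mul (isReindex_zInv hz3)).mul (isReindex_zInv hz2)).mul
      (isReindex_zInv hz1)).mul (((isReindex_zVar hz0).mul (isReindex_zVar hz3)).sub
      ((isReindex_zVar hz1).mul (isReindex_zVar hz2)))).mul ((isReindex_zVar hz2).sub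
      (isReindex_zVar hz1)))).mul ((((((isReindex_geomFactor q t l01 l02 hz0 hz1).mul
      (isReindex_omegaFactor q t l01 l02 hz0 hz1)).mul ((isReindex_geomFactor q t l02 l01 hz0
      hz2).mul (isReindex_omegaFactor q t l02 l01 hz0 hz2))).mul ((isReindex_geomFactor q t l13
      l23 hz1 hz3).mul (isReindex_omegaFactor q t l13 l23 hz1 hz3))).mul ((isReindex_geomFactor q
      t l23 l13 hz2 hz3).mul (isReindex_omegaFactor q t l23 l13 hz2 hz3))).mul
      (isReindex_omegaFactor q t l03 l03 hz0 hz3))))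
  exact coeff_zero_vertexSeries_mul_eq_zero q t F h (by ring)

theorem coeff_zero_four_swap_zero_one :
    (vertexSeries q t 4 F *
      (zProdPow 4 c * (scalar 4 q * scalar 4 t * (zInv 2 * zInv 3 * (zVar 1 - zVar 0)) *
        (geomFactor q t 2 3 * omegaFactor q t 2 3 * (geomFactor q t 1 2 * omegaFactor q t 1 2) *
        (geomFactor q t 0 2 * omegaFactor q t 0 2) * omegaFactor q t 0 3 * omegaFactor q t 1
        3)))).coeff 0 = 0 := by
  have hz0 : Equiv.swap (0 : Fin 4) 1 0 = 1 := by decide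
  have hz1 : Equiv.swap (0 : Fin 4) 1 1 = 0 := by decide
  have hz2 : Equiv.swap (0 : Fin 4) 1 2 = 2 := by decide
  have hz3 : Equiv.swap (0 : Fin 4) 1 3 = 3 := by decide
  have l02 : (0 : Fin 4) < 2 := by decide
  have l03 : (0 : Fin 4) < 3 := by decide
  have l12 : (1 : Fin 4) < 2 := by decide
  have l13 : (1 : Fin 4) < 3 := by decide
  have l23 : (2 : Fin 4) < 3 := by decide
  have h : IsReindex (permAddEquiv (Equiv.swap (0 : Fin 4) 1))
      (zProdPow 4 c * (scalar 4 q * scalar 4 t * (zInv 2 * zInv 3 * (zVar 1 - zVar 0)) *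
        (geomFactor q t 2 3 * omegaFactor q t 2 3 * (geomFactor q t 1 2 * omegaFactor q t 1 2) *
        (geomFactor q t 0 2 * omegaFactor q t 0 2) * omegaFactor q t 0 3 * omegaFactor q t 1 3)) :
        Series K 4)
      (zProdPow 4 c * (scalar 4 q * scalar 4 t * (zInv 2 * zInv 3 * (zVar 0 - zVar 1)) *
        (geomFactor q t 2 3 * omegaFactor q t 2 3 * (geomFactor q t 0 2 * omegaFactor q t 0 2) *
        (geomFactor q t 1 2 * omegaFactor q t 1 2) * omegaFactor q t 1 3 * omegaFactor q t 0 3)))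
        :=
    ((isReindex_zProdPow c).mul ((((isReindex_scalar _).mul (isReindex_scalar _)).mul
      (((isReindex_zInv hz2).mul (isReindex_zInv hz3)).mul ((isReindex_zVar hz1).sub
      (isReindex_zVar hz0)))).mul ((((((isReindex_geomFactor q t l23 l23 hz2 hz3).mul
      (isReindex_omegaFactor q t l23 l23 hz2 hz3)).mul ((isReindex_geomFactor q t l12 l02 hz1
      hz2).mul (isReindex_omegaFactor q t l12 l02 hz1 hz2))).mul ((isReindex_geomFactor q t l02
      l12 hz0 hz2).mul (isReindex_omegaFactor q t l02 l12 hz0 hz2))).mul (isReindex_omegaFactor q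
      t l03 l13 hz0 hz3)).mul (isReindex_omegaFactor q t l13 l03 hz1 hz3))))
  exact coeff_zero_vertexSeries_mul_eq_zero q t F h (by ring)

theorem coeff_zero_three_swap_zero_one_inv :
    (vertexSeries q t 3 F *
      (zProdPow 3 c * ((zVar 1 - zVar 0) * (geomFactor q t 1 2 * omegaFactor q t 1 2 * (geomFactor
        q t 0 2 * omegaFactor q t 0 2))))).coeff 0 = 0 := by
  have hz0 : Equiv.swap (0 : Fin 3) 1 0 = 1 := by decide
  have hz1 : Equiv.swap (0 : Fin 3) 1 1 = 0 := by decide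
  have hz2 : Equiv.swap (0 : Fin 3) 1 2 = 2 := by decide
  have l02 : (0 : Fin 3) < 2 := by decide
  have l12 : (1 : Fin 3) < 2 := by decide
  have h : IsReindex (permAddEquiv (Equiv.swap (0 : Fin 3) 1))
      (zProdPow 3 c * ((zVar 1 - zVar 0) * (geomFactor q t 1 2 * omegaFactor q t 1 2 * (geomFactor
        q t 0 2 * omegaFactor q t 0 2))) : Series K 3)
      (zProdPow 3 c * ((zVar 0 - zVar 1) * (geomFactor q t 0 2 * omegaFactor q t 0 2 * (geomFactor
        q t 1 2 * omegaFactor q t 1 2)))) :=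
    ((isReindex_zProdPow c).mul (((isReindex_zVar hz1).sub (isReindex_zVar hz0)).mul
      (((isReindex_geomFactor q t l12 l02 hz1 hz2).mul (isReindex_omegaFactor q t l12 l02 hz1
      hz2)).mul ((isReindex_geomFactor q t l02 l12 hz0 hz2).mul (isReindex_omegaFactor q t l02 l12
      hz0 hz2)))))
  exact coeff_zero_vertexSeries_mul_eq_zero q t F h (by ring)

theorem coeff_zero_three_swap_one_two_inv :
    (vertexSeries q t 3 F *
      (zProdPow 3 c * (scalar 3 q * scalar 3 t * (zVar 0 * zVar 0 * (zInv 1 - zInv 2)) *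
        (geomFactor q t 0 2 * omegaFactor q t 0 2 * (geomFactor q t 0 1 * omegaFactor q t 0
        1))))).coeff 0 = 0 := by
  have hz0 : Equiv.swap (1 : Fin 3) 2 0 = 0 := by decide
  have hz1 : Equiv.swap (1 : Fin 3) 2 1 = 2 := by decide
  have hz2 : Equiv.swap (1 : Fin 3) 2 2 = 1 := by decide
  have l01 : (0 : Fin 3) < 1 := by decide
  have l02 : (0 : Fin 3) < 2 := by decide
  have h : IsReindex (permAddEquiv (Equiv.swap (1 : Fin 3) 2))
      (zProdPow 3 c * (scalar 3 q * scalar 3 t * (zVar 0 * zVar 0 * (zInv 1 - zInv 2)) *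
        (geomFactor q t 0 2 * omegaFactor q t 0 2 * (geomFactor q t 0 1 * omegaFactor q t 0 1))) :
        Series K 3)
      (zProdPow 3 c * (scalar 3 q * scalar 3 t * (zVar 0 * zVar 0 * (zInv 2 - zInv 1)) *
        (geomFactor q t 0 1 * omegaFactor q t 0 1 * (geomFactor q t 0 2 * omegaFactor q t 0 2))))
        :=
    ((isReindex_zProdPow c).mul ((((isReindex_scalar _).mul (isReindex_scalar _)).mul
      (((isReindex_zVar hz0).mul (isReindex_zVar hz0)).mul ((isReindex_zInv hz1).sub
      (isReindex_zInv hz2)))).mul (((isReindex_geomFactor q t l02 l01 hz0 hz2).mul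
      (isReindex_omegaFactor q t l02 l01 hz0 hz2)).mul ((isReindex_geomFactor q t l01 l02 hz0
      hz1).mul (isReindex_omegaFactor q t l01 l02 hz0 hz1)))))
  exact coeff_zero_vertexSeries_mul_eq_zero q t F h (by ring)

theorem coeff_zero_four_swap_zero_one_inv :
    (vertexSeries q t 4 F *
      (zProdPow 4 c * ((zVar 1 - zVar 0) * (geomFactor q t 2 3 * omegaFactor q t 2 3 * (geomFactor
        q t 1 2 * omegaFactor q t 1 2) * (geomFactor q t 0 2 * omegaFactor q t 0 2) * omegaFactor
        q t 1 3 * omegaFactor q t 0 3)))).coeff 0 = 0 := by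
  have hz0 : Equiv.swap (0 : Fin 4) 1 0 = 1 := by decide
  have hz1 : Equiv.swap (0 : Fin 4) 1 1 = 0 := by decide
  have hz2 : Equiv.swap (0 : Fin 4) 1 2 = 2 := by decide
  have hz3 : Equiv.swap (0 : Fin 4) 1 3 = 3 := by decide
  have l02 : (0 : Fin 4) < 2 := by decide
  have l03 : (0 : Fin 4) < 3 := by decide
  have l12 : (1 : Fin 4) < 2 := by decide
  have l13 : (1 : Fin 4) < 3 := by decide
  have l23 : (2 : Fin 4) < 3 := by decide
  have h : IsReindex (permAddEquiv (Equiv.swap (0 : Fin 4) 1))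
      (zProdPow 4 c * ((zVar 1 - zVar 0) * (geomFactor q t 2 3 * omegaFactor q t 2 3 * (geomFactor
        q t 1 2 * omegaFactor q t 1 2) * (geomFactor q t 0 2 * omegaFactor q t 0 2) * omegaFactor
        q t 1 3 * omegaFactor q t 0 3)) : Series K 4)
      (zProdPow 4 c * ((zVar 0 - zVar 1) * (geomFactor q t 2 3 * omegaFactor q t 2 3 * (geomFactor
        q t 0 2 * omegaFactor q t 0 2) * (geomFactor q t 1 2 * omegaFactor q t 1 2) * omegaFactor
        q t 0 3 * omegaFactor q t 1 3))) :=
    ((isReindex_zProdPow c).mul (((isReindex_zVar hz1).sub (isReindex_zVar hz0)).mul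
      ((((((isReindex_geomFactor q t l23 l23 hz2 hz3).mul (isReindex_omegaFactor q t l23 l23 hz2
      hz3)).mul ((isReindex_geomFactor q t l12 l02 hz1 hz2).mul (isReindex_omegaFactor q t l12 l02
      hz1 hz2))).mul ((isReindex_geomFactor q t l02 l12 hz0 hz2).mul (isReindex_omegaFactor q t
      l02 l12 hz0 hz2))).mul (isReindex_omegaFactor q t l13 l03 hz1 hz3)).mul
      (isReindex_omegaFactor q t l03 l13 hz0 hz3))))
  exact coeff_zero_vertexSeries_mul_eq_zero q t F h (by ring)

theorem coeff_zero_four_swap_one_two_inv :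
    (vertexSeries q t 4 F *
      (zProdPow 4 c * (scalar 4 q * scalar 4 t * (zVar 0 * zVar 0 * zVar 1 * zVar 2 * (zInv 3 *
        zInv 0 - zInv 2 * zInv 1) * (zInv 1 - zInv 2)) * (geomFactor q t 2 3 * omegaFactor q t 2 3
        * (geomFactor q t 1 3 * omegaFactor q t 1 3) * (geomFactor q t 0 2 * omegaFactor q t 0 2)
        * (geomFactor q t 0 1 * omegaFactor q t 0 1) * omegaFactor q t 0 3)))).coeff 0 = 0 := by
  have hz0 : Equiv.swap (1 : Fin 4) 2 0 = 0 := by decide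
  have hz1 : Equiv.swap (1 : Fin 4) 2 1 = 2 := by decide
  have hz2 : Equiv.swap (1 : Fin 4) 2 2 = 1 := by decide
  have hz3 : Equiv.swap (1 : Fin 4) 2 3 = 3 := by decide
  have l01 : (0 : Fin 4) < 1 := by decide
  have l02 : (0 : Fin 4) < 2 := by decide
  have l03 : (0 : Fin 4) < 3 := by decide
  have l13 : (1 : Fin 4) < 3 := by decide
  have l23 : (2 : Fin 4) < 3 := by decide
  have h : IsReindex (permAddEquiv (Equiv.swap (1 : Fin 4) 2))
      (zProdPow 4 c * (scalar 4 q * scalar 4 t * (zVar 0 * zVar 0 * zVar 1 * zVar 2 * (zInv 3 *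
        zInv 0 - zInv 2 * zInv 1) * (zInv 1 - zInv 2)) * (geomFactor q t 2 3 * omegaFactor q t 2 3
        * (geomFactor q t 1 3 * omegaFactor q t 1 3) * (geomFactor q t 0 2 * omegaFactor q t 0 2)
        * (geomFactor q t 0 1 * omegaFactor q t 0 1) * omegaFactor q t 0 3)) : Series K 4)
      (zProdPow 4 c * (scalar 4 q * scalar 4 t * (zVar 0 * zVar 0 * zVar 2 * zVar 1 * (zInv 3 *
        zInv 0 - zInv 1 * zInv 2) * (zInv 2 - zInv 1)) * (geomFactor q t 1 3 * omegaFactor q t 1 3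
        * (geomFactor q t 2 3 * omegaFactor q t 2 3) * (geomFactor q t 0 1 * omegaFactor q t 0 1)
        * (geomFactor q t 0 2 * omegaFactor q t 0 2) * omegaFactor q t 0 3))) :=
    ((isReindex_zProdPow c).mul ((((isReindex_scalar _).mul (isReindex_scalar _)).mul
      ((((((isReindex_zVar hz0).mul (isReindex_zVar hz0)).mul (isReindex_zVar hz1)).mul
      (isReindex_zVar hz2)).mul (((isReindex_zInv hz3).mul (isReindex_zInv hz0)).sub
      ((isReindex_zInv hz2).mul (isReindex_zInv hz1)))).mul ((isReindex_zInv hz1).sub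
      (isReindex_zInv hz2)))).mul ((((((isReindex_geomFactor q t l23 l13 hz2 hz3).mul
      (isReindex_omegaFactor q t l23 l13 hz2 hz3)).mul ((isReindex_geomFactor q t l13 l23 hz1
      hz3).mul (isReindex_omegaFactor q t l13 l23 hz1 hz3))).mul ((isReindex_geomFactor q t l02
      l01 hz0 hz2).mul (isReindex_omegaFactor q t l02 l01 hz0 hz2))).mul ((isReindex_geomFactor q
      t l01 l02 hz0 hz1).mul (isReindex_omegaFactor q t l01 l02 hz0 hz1))).mul
      (isReindex_omegaFactor q t l03 l03 hz0 hz3))))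
  exact coeff_zero_vertexSeries_mul_eq_zero q t F h (by ring)

theorem coeff_zero_four_swap_two_three_inv :
    (vertexSeries q t 4 F *
      (zProdPow 4 c * (scalar 4 q * scalar 4 t * (zVar 1 * zVar 0 * (zInv 2 - zInv 3)) *
        (geomFactor q t 0 1 * omegaFactor q t 0 1 * (geomFactor q t 1 2 * omegaFactor q t 1 2) *
        (geomFactor q t 1 3 * omegaFactor q t 1 3) * omegaFactor q t 0 3 * omegaFactor q t 0
        2)))).coeff 0 = 0 := by
  have hz0 : Equiv.swap (2 : Fin 4) 3 0 = 0 := by decide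
  have hz1 : Equiv.swap (2 : Fin 4) 3 1 = 1 := by decide
  have hz2 : Equiv.swap (2 : Fin 4) 3 2 = 3 := by decide
  have hz3 : Equiv.swap (2 : Fin 4) 3 3 = 2 := by decide
  have l01 : (0 : Fin 4) < 1 := by decide
  have l02 : (0 : Fin 4) < 2 := by decide
  have l03 : (0 : Fin 4) < 3 := by decide
  have l12 : (1 : Fin 4) < 2 := by decide
  have l13 : (1 : Fin 4) < 3 := by decide
  have h : IsReindex (permAddEquiv (Equiv.swap (2 : Fin 4) 3))
      (zProdPow 4 c * (scalar 4 q * scalar 4 t * (zVar 1 * zVar 0 * (zInv 2 - zInv 3)) *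
        (geomFactor q t 0 1 * omegaFactor q t 0 1 * (geomFactor q t 1 2 * omegaFactor q t 1 2) *
        (geomFactor q t 1 3 * omegaFactor q t 1 3) * omegaFactor q t 0 3 * omegaFactor q t 0 2)) :
        Series K 4)
      (zProdPow 4 c * (scalar 4 q * scalar 4 t * (zVar 1 * zVar 0 * (zInv 3 - zInv 2)) *
        (geomFactor q t 0 1 * omegaFactor q t 0 1 * (geomFactor q t 1 3 * omegaFactor q t 1 3) *
        (geomFactor q t 1 2 * omegaFactor q t 1 2) * omegaFactor q t 0 2 * omegaFactor q t 0 3)))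
        :=
    ((isReindex_zProdPow c).mul ((((isReindex_scalar _).mul (isReindex_scalar _)).mul
      (((isReindex_zVar hz1).mul (isReindex_zVar hz0)).mul ((isReindex_zInv hz2).sub
      (isReindex_zInv hz3)))).mul ((((((isReindex_geomFactor q t l01 l01 hz0 hz1).mul
      (isReindex_omegaFactor q t l01 l01 hz0 hz1)).mul ((isReindex_geomFactor q t l12 l13 hz1
      hz2).mul (isReindex_omegaFactor q t l12 l13 hz1 hz2))).mul ((isReindex_geomFactor q t l13
      l12 hz1 hz3).mul (isReindex_omegaFactor q t l13 l12 hz1 hz3))).mul (isReindex_omegaFactor q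
      t l03 l02 hz0 hz3)).mul (isReindex_omegaFactor q t l02 l03 hz0 hz2))))
  exact coeff_zero_vertexSeries_mul_eq_zero q t F h (by ring)

theorem commutator_three :
    kernelOp q t (zProdPow 3 c * (zInv 2 * geomFactor q t 1 2)) F -
      kernelOp q t (zProdPow 3 c * (zInv 1 * geomFactor q t 0 1)) F =
      ((1 - t) * (1 - q)) • kernelOp q t
        (zProdPow 3 c * (zInv 2 * (geomFactor q t 0 1 * geomFactor q t 1 2))) F := by
  have h01 : (0 : Fin 3) < 1 := by decide
  have h12 : (1 : Fin 3) < 2 := by decide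
  have h02 : (0 : Fin 3) < 2 := by decide
  have z1 := zVar_mul_zInv (K := K) (1 : Fin 3)
  have hr : (ratio 0 2 : Series K 3) = ratio 0 1 * ratio 1 2 := by
    simp only [ratio_eq]; linear_combination (-zVar 0 * zInv 2) * z1
  have h02' := geomFactor_mul q t h02
  rw [hr] at h02'
  -- The choice `x = 1/z₂` makes `x b = 1/z₃`, so the left side is the difference of the two
  -- composed kernels minus `M` times the Negut kernel.
  have key := kernel_identity_three (x := zInv 1) (geomFactor_mul q t h01) (geomFactor_mul q t h12)
    h02' (w13 := omegaFactor q t 0 2) (omegaFactor_mul q t h01) (omegaFactor_mul q t h12)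
  have e1 : (zInv 1 * ratio 1 2 : Series K 3) = zInv 2 := by
    rw [ratio_eq]; linear_combination zInv 2 * z1
  have e2 : (zInv 1 * (1 - ratio 1 2) : Series K 3) = zInv 1 - zInv 2 := by
    rw [mul_sub, e1, mul_one]
  have e3 : (zInv 1 * ratio 1 2 ^ 2 * (1 - ratio 0 1) : Series K 3) =
      zInv 2 * zInv 2 * (zVar 1 - zVar 0) := by
    simp only [ratio_eq]
    linear_combination (zVar 1 * zInv 2 ^ 2 * (1 - zVar 0 * zInv 1)) * z1 -
      (zVar 0 * zInv 2 ^ 2) * z1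
  rw [e1, e2, e3] at key
  refine kernelOp_sub_eq_of_eq_neg q t _ ?_ (coeff_zero_mul_sub
    (coeff_zero_three_swap_one_two q t c F) (coeff_zero_three_swap_zero_one q t c F))
  rw [interaction_three, map_mul, map_sub, map_sub, map_one]
  linear_combination zProdPow 3 c * key

theorem commutator_three_inv :
    kernelOp q t (zProdPow 3 c * (zVar 0 * geomFactor q t 0 1)) F -
      kernelOp q t (zProdPow 3 c * (zVar 1 * geomFactor q t 1 2)) F =
      ((1 - t) * (1 - q)) • kernelOp q t
        (zProdPow 3 c * (zVar 0 * (geomFactor q t 0 1 * geomFactor q t 1 2))) F := by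
  have h01 : (0 : Fin 3) < 1 := by decide
  have h12 : (1 : Fin 3) < 2 := by decide
  have h02 : (0 : Fin 3) < 2 := by decide
  have z1 := zVar_mul_zInv (K := K) (1 : Fin 3)
  have hr : (ratio 0 2 : Series K 3) = ratio 1 2 * ratio 0 1 := by
    simp only [ratio_eq]; linear_combination (-zVar 0 * zInv 2) * z1
  have h02' := geomFactor_mul q t h02
  rw [hr] at h02'
  -- The inversion `z_i ↦ 1/z_{4-i}` exchanges `z₁/z₂` with `z₂/z₃`, so the same identity is used
  -- with `a` and `b` interchanged and `x = z₂`.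
  have key := kernel_identity_three (x := zVar 1) (geomFactor_mul q t h12) (geomFactor_mul q t h01)
    h02' (w13 := omegaFactor q t 0 2) (omegaFactor_mul q t h12) (omegaFactor_mul q t h01)
  have e1 : (zVar 1 * ratio 0 1 : Series K 3) = zVar 0 := by
    rw [ratio_eq]; linear_combination zVar 0 * z1
  have e2 : (zVar 1 * (1 - ratio 0 1) : Series K 3) = zVar 1 - zVar 0 := by
    rw [mul_sub, e1, mul_one]
  have e3 : (zVar 1 * ratio 0 1 ^ 2 * (1 - ratio 1 2) : Series K 3) =
      zVar 0 * zVar 0 * (zInv 1 - zInv 2) := by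
    simp only [ratio_eq]
    linear_combination (zInv 1 * zVar 0 ^ 2 * (1 - zVar 1 * zInv 2)) * z1 -
      (zVar 0 ^ 2 * zInv 2) * z1
  rw [e1, e2, e3] at key
  refine kernelOp_sub_eq_of_eq_neg q t _ ?_ (coeff_zero_mul_sub
    (coeff_zero_three_swap_zero_one_inv q t c F) (coeff_zero_three_swap_one_two_inv q t c F))
  rw [interaction_three, map_mul, map_sub, map_sub, map_one]
  linear_combination zProdPow 3 c * key

theorem commutator_four :
    kernelOp q t (zProdPow 4 c * (zInv 3 * (geomFactor q t 1 2 * geomFactor q t 2 3))) F -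
      kernelOp q t (zProdPow 4 c * (zInv 2 * (geomFactor q t 0 1 * geomFactor q t 1 2))) F =
      ((1 - t) * (1 - q)) • kernelOp q t (zProdPow 4 c *
        (zInv 3 * (geomFactor q t 0 1 * geomFactor q t 1 2 * geomFactor q t 2 3))) F := by
  have h01 : (0 : Fin 4) < 1 := by decide
  have h12 : (1 : Fin 4) < 2 := by decide
  have h23 : (2 : Fin 4) < 3 := by decide
  have h02 : (0 : Fin 4) < 2 := by decide
  have h13 : (1 : Fin 4) < 3 := by decide
  have z1 := zVar_mul_zInv (K := K) (1 : Fin 4)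
  have z2 := zVar_mul_zInv (K := K) (2 : Fin 4)
  have z3 := zVar_mul_zInv (K := K) (3 : Fin 4)
  have hr : (ratio 0 2 : Series K 4) = ratio 0 1 * ratio 1 2 := by
    simp only [ratio_eq]; linear_combination (-zVar 0 * zInv 2) * z1
  have hs : (ratio 1 3 : Series K 4) = ratio 1 2 * ratio 2 3 := by
    simp only [ratio_eq]; linear_combination (-zVar 1 * zInv 3) * z2
  have h02' := geomFactor_mul q t h02
  have h13' := geomFactor_mul q t h13
  rw [hr] at h02'
  rw [hs] at h13'
  -- Here `x = 1/z₃`, so that `x c = 1/z₄`. No relation is needed for `w13`, `w14`, `w24`, which are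
  -- only carried along.
  have key := kernel_identity_four (x := zInv 2) (geomFactor_mul q t h01)
    (geomFactor_mul q t h12) (geomFactor_mul q t h23) h02' h13'
    (w13 := omegaFactor q t 0 2) (w24 := omegaFactor q t 1 3) (w14 := omegaFactor q t 0 3)
    (omegaFactor_mul q t h01) (omegaFactor_mul q t h12) (omegaFactor_mul q t h23)
  have e0 : (zInv 2 * ratio 2 3 : Series K 4) = zInv 3 := by
    rw [ratio_eq]; linear_combination zInv 3 * z2
  have e1 : (zInv 2 * (1 - ratio 2 3) : Series K 4) = zInv 2 - zInv 3 := by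
    rw [mul_sub, e0, mul_one]
  have e2 : (zInv 2 * ratio 2 3 * (ratio 0 1 - ratio 2 3) * (1 - ratio 1 2) : Series K 4) =
      zInv 3 * zInv 3 * zInv 2 * zInv 1 * (zVar 0 * zVar 3 - zVar 1 * zVar 2) *
        (zVar 2 - zVar 1) := by
    rw [e0]
    simp only [ratio_eq]
    linear_combination (-zInv 3 * zInv 1 * zInv 3 * (zVar 0 * zVar 3 - zVar 1 * zVar 2)) * z2 -
      zInv 3 * (1 - zVar 1 * zInv 2) * (zVar 0 * zInv 1 * z3 - zVar 2 * zInv 3 * z1)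
  have e3 : (zInv 2 * (ratio 1 2 * ratio 2 3) * (1 - ratio 0 1) : Series K 4) =
      zInv 2 * zInv 3 * (zVar 1 - zVar 0) := by
    simp only [ratio_eq]
    linear_combination (zInv 2 * zVar 1 * zInv 3 * (1 - zVar 0 * zInv 1)) * z2 -
      (zInv 2 * zInv 3 * zVar 0) * z1
  rw [e2, e3, e1, e0] at key
  refine kernelOp_sub_eq_of_eq_neg q t _ ?_ (coeff_zero_mul_sub (coeff_zero_mul_add
    (coeff_zero_four_swap_two_three q t c F) (coeff_zero_four_swap_one_two q t c F))
    (coeff_zero_four_swap_zero_one q t c F))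
  rw [interaction_four, map_mul, map_sub, map_sub, map_one]
  linear_combination zProdPow 4 c * key

theorem commutator_four_inv :
    kernelOp q t (zProdPow 4 c * (zVar 0 * (geomFactor q t 0 1 * geomFactor q t 1 2))) F -
      kernelOp q t (zProdPow 4 c * (zVar 1 * (geomFactor q t 1 2 * geomFactor q t 2 3))) F =
      ((1 - t) * (1 - q)) • kernelOp q t (zProdPow 4 c *
        (zVar 0 * (geomFactor q t 0 1 * geomFactor q t 1 2 * geomFactor q t 2 3))) F := by
  have h01 : (0 : Fin 4) < 1 := by decide
  have h12 : (1 : Fin 4) < 2 := by decide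
  have h23 : (2 : Fin 4) < 3 := by decide
  have h02 : (0 : Fin 4) < 2 := by decide
  have h13 : (1 : Fin 4) < 3 := by decide
  have z0 := zVar_mul_zInv (K := K) (0 : Fin 4)
  have z1 := zVar_mul_zInv (K := K) (1 : Fin 4)
  have z2 := zVar_mul_zInv (K := K) (2 : Fin 4)
  have hr : (ratio 0 2 : Series K 4) = ratio 1 2 * ratio 0 1 := by
    simp only [ratio_eq]; linear_combination (-zVar 0 * zInv 2) * z1
  have hs : (ratio 1 3 : Series K 4) = ratio 2 3 * ratio 1 2 := by
    simp only [ratio_eq]; linear_combination (-zVar 1 * zInv 3) * z2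
  have h02' := geomFactor_mul q t h02
  have h13' := geomFactor_mul q t h13
  rw [hr] at h02'
  rw [hs] at h13'
  -- Under `z_i ↦ 1/z_{5-i}` the ratios `z₁/z₂` and `z₃/z₄` trade places, as do the pairs `(1,3)`
  -- and `(2,4)`; the middle ratio stays.
  have key := kernel_identity_four (x := zVar 1) (geomFactor_mul q t h23)
    (geomFactor_mul q t h12) (geomFactor_mul q t h01) h13' h02'
    (w13 := omegaFactor q t 1 3) (w24 := omegaFactor q t 0 2) (w14 := omegaFactor q t 0 3)
    (omegaFactor_mul q t h23) (omegaFactor_mul q t h12) (omegaFactor_mul q t h01)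
  have e0 : (zVar 1 * ratio 0 1 : Series K 4) = zVar 0 := by
    rw [ratio_eq]; linear_combination zVar 0 * z1
  have e1 : (zVar 1 * (1 - ratio 0 1) : Series K 4) = zVar 1 - zVar 0 := by
    rw [mul_sub, e0, mul_one]
  have e2 : (zVar 1 * ratio 0 1 * (ratio 2 3 - ratio 0 1) * (1 - ratio 1 2) : Series K 4) =
      zVar 0 * zVar 0 * zVar 1 * zVar 2 * (zInv 3 * zInv 0 - zInv 2 * zInv 1) *
        (zInv 1 - zInv 2) := by
    rw [e0]
    simp only [ratio_eq]
    linear_combination (-zVar 0 * zVar 2 * zVar 0 * (zInv 3 * zInv 0 - zInv 2 * zInv 1)) * z1 -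
      zVar 0 * (1 - zVar 1 * zInv 2) * (zInv 3 * zVar 2 * z0 - zInv 1 * zVar 0 * z2)
  have e3 : (zVar 1 * (ratio 1 2 * ratio 0 1) * (1 - ratio 2 3) : Series K 4) =
      zVar 1 * zVar 0 * (zInv 2 - zInv 3) := by
    simp only [ratio_eq]
    linear_combination (zVar 1 * zInv 2 * zVar 0 * (1 - zInv 3 * zVar 2)) * z1 -
      (zVar 1 * zVar 0 * zInv 3) * z2
  rw [e2, e3, e1, e0] at key
  refine kernelOp_sub_eq_of_eq_neg q t _ ?_ (coeff_zero_mul_sub (coeff_zero_mul_add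
    (coeff_zero_four_swap_zero_one_inv q t c F) (coeff_zero_four_swap_one_two_inv q t c F))
    (coeff_zero_four_swap_two_three_inv q t c F))
  rw [interaction_four, map_mul, map_sub, map_sub, map_one]
  linear_combination zProdPow 4 c * key

end Commutators

/-! ### Explicit exponents, the commutators with `D_c`, and the induction on the number of variables
-/

section MainTheorem

variable {K : Type*} [Field K] [CharZero K] (q t : K) (k : ℕ) (F : Sym K)

theorem D_eq_kernelOp_zProdPow (c : ℤ) :
    D q t c F = kernelOp q t (zProdPow 1 (-c) * 1) F := by
  rw [mul_one]
  exact D_eq_kernelOp q t c F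

/-- Splitting off the power `-c` instead of `-(c+1)` gives the same common power as for `D_c`, as
composition requires. -/
theorem D_succ_eq_kernelOp (c : ℤ) :
    D q t (c + 1) F = kernelOp q t (zProdPow 1 (-c) * zInv 0) F := by
  rw [D_eq_kernelOp, zInv, zProdPow_mul_mono]
  congr 2
  funext i
  rw [Subsingleton.elim i 0, Pi.single_eq_same]
  ring

theorem N_eq_kernelOp_of_eq {m n : ℕ} {c : ℤ} {v : Fin m → ℤ} {g : Series K m}
    (hv : ∀ i : Fin m, -((((i : ℕ) + 1) * n / m : ℕ) - ((i : ℕ) * n / m : ℕ) : ℤ) = c + v i)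
    (hg : ∏ x : Fin m × Fin m with (x.1 : ℕ) + 1 = x.2, geomFactor q t x.1 x.2 = g) :
    N q t m n F = kernelOp q t (zProdPow m c * (mono v * g)) F := by
  rw [N_eq_kernelOp, funext hv, ← hg, ← mul_assoc, zProdPow_mul_mono]
  rfl

theorem prod_geomFactor_two : ∏ x : Fin 2 × Fin 2 with (x.1 : ℕ) + 1 = x.2,
    geomFactor q t x.1 x.2 = geomFactor q t 0 1 := by
  simp [Finset.prod_filter, Fintype.prod_prod_type, Fin.prod_univ_succ]

theorem prod_geomFactor_three : ∏ x : Fin 3 × Fin 3 with (x.1 : ℕ) + 1 = x.2,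
    geomFactor q t x.1 x.2 = geomFactor q t 0 1 * geomFactor q t 1 2 := by
  simp [Finset.prod_filter, Fintype.prod_prod_type, Fin.prod_univ_succ]

theorem prod_geomFactor_four : ∏ x : Fin 4 × Fin 4 with (x.1 : ℕ) + 1 = x.2,
    geomFactor q t x.1 x.2 = geomFactor q t 0 1 * geomFactor q t 1 2 * geomFactor q t 2 3 := by
  simp [Finset.prod_filter, Fintype.prod_prod_type, Fin.prod_univ_succ, mul_assoc]

theorem N_two : N q t 2 (2 * k + 1) F = kernelOp q t (zProdPow 2 (-k) *
    (zInv 1 * geomFactor q t 0 1)) F := by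
  refine N_eq_kernelOp_of_eq q t F (fun i => ?_) (prod_geomFactor_two q t)
  fin_cases i <;> simp <;> omega

/-- For `m = 2` the residues `1` and `m - 1` coincide, so the same operator is written in two ways:
`N_two` matches compositions with `D_k`, this form those with `D_{k+1}`. -/
theorem N_two_inv : N q t 2 (2 * k + 1) F = kernelOp q t (zProdPow 2 (-(k + 1)) *
    (zVar 0 * geomFactor q t 0 1)) F := by
  refine N_eq_kernelOp_of_eq q t F (fun i => ?_) (prod_geomFactor_two q t)
  fin_cases i <;> simp <;> omega

/-- For `n = mk + 1` one has `⌊i n/m⌋ = ik` for `i < m`, so only the last exponent is `k + 1`. -/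
theorem N_three : N q t 3 (3 * k + 1) F = kernelOp q t (zProdPow 3 (-k) *
    (zInv 2 * (geomFactor q t 0 1 * geomFactor q t 1 2))) F := by
  refine N_eq_kernelOp_of_eq q t F (fun i => ?_) (prod_geomFactor_three q t)
  fin_cases i <;> simp <;> omega

/-- For `n = mk + m - 1` one has `⌊i n/m⌋ = i(k + 1) - 1` for `1 ≤ i ≤ m`, so only the first
exponent is `k`; hence the numerator `z₁`. -/
theorem N_three_inv : N q t 3 (3 * k + 2) F = kernelOp q t (zProdPow 3 (-(k + 1)) *
    (zVar 0 * (geomFactor q t 0 1 * geomFactor q t 1 2))) F := by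
  refine N_eq_kernelOp_of_eq q t F (fun i => ?_) (prod_geomFactor_three q t)
  fin_cases i <;> simp <;> omega

theorem N_four : N q t 4 (4 * k + 1) F = kernelOp q t (zProdPow 4 (-k) *
    (zInv 3 * (geomFactor q t 0 1 * geomFactor q t 1 2 * geomFactor q t 2 3))) F := by
  refine N_eq_kernelOp_of_eq q t F (fun i => ?_) (prod_geomFactor_four q t)
  fin_cases i <;> simp <;> omega

theorem N_four_inv : N q t 4 (4 * k + 3) F = kernelOp q t (zProdPow 4 (-(k + 1)) *
    (zVar 0 * (geomFactor q t 0 1 * geomFactor q t 1 2 * geomFactor q t 2 3))) F := by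
  refine N_eq_kernelOp_of_eq q t F (fun i => ?_) (prod_geomFactor_four q t)
  fin_cases i <;> simp <;> omega

theorem isIterate_one_left (m₁ m₂ : ℕ) :
    IsIterate (appendAddEquiv m₁ m₂) (hahnMap (shiftAll q t m₂) 1) (1 : Series K (m₁ + m₂)) := by
  rw [map_one]
  exact IsIterate.C 1

theorem isIterate_one_right (m₁ m₂ : ℕ) :
    IsIterate (appendAddEquiv m₁ m₂) (HahnSeries.C (1 : Series K m₂))
      (1 : Series K (m₁ + m₂)) :=
  IsIterate.C 1

/-- Composition with `D_c` acting first: the variables of the kernel are shifted by one place. -/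
theorem kernelOp_D (c : ℤ) {m : ℕ} {g : Series K m} {G : Series K (1 + m)}
    (h : IsIterate (appendAddEquiv 1 m) (HahnSeries.C g) G) :
    kernelOp q t (zProdPow m (-c) * g) (D q t c F) = kernelOp q t (zProdPow (1 + m) (-c) * G) F := by
  rw [D_eq_kernelOp_zProdPow, kernelOp_zProdPow_comp q t (-c) (isIterate_one_left q t 1 m) h,
    one_mul]

/-- Composition with `D_c` acting last: the kernel is kept, with one variable added. -/
theorem D_kernelOp (c : ℤ) {m : ℕ} {g : Series K m} {G : Series K (m + 1)}
    (h : IsIterate (appendAddEquiv m 1) (hahnMap (shiftAll q t 1) g) G) :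
    D q t c (kernelOp q t (zProdPow m (-c) * g) F) = kernelOp q t (zProdPow (m + 1) (-c) * G) F := by
  rw [D_eq_kernelOp_zProdPow, kernelOp_zProdPow_comp q t (-c) h (isIterate_one_right m 1),
    mul_one]

theorem D_commutator : D q t (k + 1) (D q t k F) - D q t k (D q t (k + 1) F) =
    ((1 - t) * (1 - q)) • N q t 2 (2 * k + 1) F := by
  have h1 := kernelOp_D q t F k (m := 1)
    (isIterate_zInv_right (K := K) (i := 0) (i' := (1 : Fin 2)) rfl)
  have h2 := D_kernelOp q t F k (m := 1)
    (isIterate_zInv_left q t (i := 0) (i' := (0 : Fin 2)) rfl)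
  rw [N_two, ← commutator_two, D_succ_eq_kernelOp, D_succ_eq_kernelOp, h1, h2]

/-- When `D_k` acts first, the variables of `N` move one place to the right; when it acts last, they
stay. These are the two kernels compared in `commutator_three`. -/
theorem N_two_commutator_D :
    N q t 2 (2 * k + 1) (D q t k F) - D q t k (N q t 2 (2 * k + 1) F) =
      ((1 - t) * (1 - q)) • N q t 3 (3 * k + 1) F := by
  have h1 := (isIterate_zInv_right (K := K) (m₁ := 1) (i := (1 : Fin 2)) (i' := (2 : Fin 3))
    rfl).mul (isIterate_geomFactor_right q t (i := 0) (j := 1) (i' := (1 : Fin 3)) (j' := (2 : Fin 3))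
      (by decide) rfl rfl)
  have h2 := (isIterate_zInv_left q t (m₂ := 1) (i := (1 : Fin 2)) (i' := (1 : Fin 3))
    rfl).mul (isIterate_geomFactor_left q t (i := 0) (j := 1) (i' := (0 : Fin 3)) (j' := (1 : Fin 3))
      (by decide) rfl rfl)
  rw [← map_mul] at h1 h2
  rw [N_three, ← commutator_three, N_two, N_two, kernelOp_D q t F k h1, D_kernelOp q t F k h2]

theorem D_commutator_N_two :
    D q t (k + 1) (N q t 2 (2 * k + 1) F) - N q t 2 (2 * k + 1) (D q t (k + 1) F) =
      ((1 - t) * (1 - q)) • N q t 3 (3 * k + 2) F := by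
  have h1 := (isIterate_zVar_right (K := K) (m₁ := 1) (i := (0 : Fin 2)) (i' := (1 : Fin 3))
    rfl).mul (isIterate_geomFactor_right q t (i := 0) (j := 1) (i' := (1 : Fin 3)) (j' := (2 : Fin 3))
      (by decide) rfl rfl)
  have h2 := (isIterate_zVar_left q t (m₂ := 1) (i := (0 : Fin 2)) (i' := (0 : Fin 3))
    rfl).mul (isIterate_geomFactor_left q t (i := 0) (j := 1) (i' := (0 : Fin 3)) (j' := (1 : Fin 3))
      (by decide) rfl rfl)
  rw [← map_mul] at h1 h2
  rw [N_three_inv, ← commutator_three_inv, N_two_inv, N_two_inv, kernelOp_D q t F (k + 1) h1,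
    D_kernelOp q t F (k + 1) h2]

theorem N_three_commutator_D :
    N q t 3 (3 * k + 1) (D q t k F) - D q t k (N q t 3 (3 * k + 1) F) =
      ((1 - t) * (1 - q)) • N q t 4 (4 * k + 1) F := by
  have h1 := (isIterate_zInv_right (K := K) (m₁ := 1) (i := (2 : Fin 3)) (i' := (3 : Fin 4))
    rfl).mul ((isIterate_geomFactor_right q t (i := 0) (j := 1) (i' := (1 : Fin 4))
      (j' := (2 : Fin 4)) (by decide) rfl rfl).mul
      (isIterate_geomFactor_right q t (i := 1) (j := 2) (i' := (2 : Fin 4)) (j' := (3 : Fin 4))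
      (by decide) rfl rfl))
  have h2 := (isIterate_zInv_left q t (m₂ := 1) (i := (2 : Fin 3)) (i' := (2 : Fin 4))
    rfl).mul ((isIterate_geomFactor_left q t (i := 0) (j := 1) (i' := (0 : Fin 4))
      (j' := (1 : Fin 4)) (by decide) rfl rfl).mul
      (isIterate_geomFactor_left q t (i := 1) (j := 2) (i' := (1 : Fin 4)) (j' := (2 : Fin 4))
      (by decide) rfl rfl))
  rw [← map_mul, ← map_mul] at h1 h2
  rw [N_four, ← commutator_four, N_three, N_three, kernelOp_D q t F k h1, D_kernelOp q t F k h2]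

theorem D_commutator_N_three :
    D q t (k + 1) (N q t 3 (3 * k + 2) F) - N q t 3 (3 * k + 2) (D q t (k + 1) F) =
      ((1 - t) * (1 - q)) • N q t 4 (4 * k + 3) F := by
  have h1 := (isIterate_zVar_right (K := K) (m₁ := 1) (i := (0 : Fin 3)) (i' := (1 : Fin 4))
    rfl).mul ((isIterate_geomFactor_right q t (i := 0) (j := 1) (i' := (1 : Fin 4))
      (j' := (2 : Fin 4)) (by decide) rfl rfl).mul
      (isIterate_geomFactor_right q t (i := 1) (j := 2) (i' := (2 : Fin 4)) (j' := (3 : Fin 4))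
      (by decide) rfl rfl))
  have h2 := (isIterate_zVar_left q t (m₂ := 1) (i := (0 : Fin 3)) (i' := (0 : Fin 4))
    rfl).mul ((isIterate_geomFactor_left q t (i := 0) (j := 1) (i' := (0 : Fin 4))
      (j' := (1 : Fin 4)) (by decide) rfl rfl).mul
      (isIterate_geomFactor_left q t (i := 1) (j := 2) (i' := (1 : Fin 4)) (j' := (2 : Fin 4))
      (by decide) rfl rfl))
  rw [← map_mul, ← map_mul] at h1 h2
  rw [N_four_inv, ← commutator_four_inv, N_three_inv, N_three_inv, kernelOp_D q t F (k + 1) h1,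
    D_kernelOp q t F (k + 1) h2]

variable {q t}

theorem Q_two (hM : (1 - t) * (1 - q) ≠ 0) : Q q t 2 (2 * k + 1) = N q t 2 (2 * k + 1) := by
  have hs : split 2 (2 * k + 1) = (1, k) := by
    -- For `k = 0` the second coordinate is `1` and the separate rule `Split(m,1)` applies; it
    -- happens to give the same formula.
    rcases Nat.eq_zero_or_pos k with rfl | hk
    · simp [split]
    · exact split_eq le_rfl (by omega) (by omega) (by omega)
  rw [Q_eq q t (by omega) (by omega) (by simp) hs, show 2 - 1 = 1 from rfl,
    show 2 * k + 1 - k = k + 1 by omega, Q_one_eq_D hM, Q_one_eq_D hM]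
  refine LinearMap.ext fun F => (inv_smul_eq_iff₀ hM).mpr ?_
  have := D_commutator q t k F
  exact_mod_cast this

theorem Q_three (hM : (1 - t) * (1 - q) ≠ 0) : Q q t 3 (3 * k + 1) = N q t 3 (3 * k + 1) := by
  have hs : split 3 (3 * k + 1) = (1, k) := by
    rcases Nat.eq_zero_or_pos k with rfl | hk
    · simp [split]
    · exact split_eq le_rfl (by omega) (by omega) (by omega)
  rw [Q_eq q t (by omega) (by omega) (by simp) hs, show 3 - 1 = 2 from rfl,
    show 3 * k + 1 - k = 2 * k + 1 by omega, Q_one_eq_D hM, Q_two k hM]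
  exact LinearMap.ext fun F => (inv_smul_eq_iff₀ hM).mpr (N_two_commutator_D q t k F)

theorem Q_three_inv (hM : (1 - t) * (1 - q) ≠ 0) :
    Q q t 3 (3 * k + 2) = N q t 3 (3 * k + 2) := by
  have hs : split 3 (3 * k + 2) = (2, 2 * k + 1) :=
    split_eq (by omega) (by omega) (by omega) (by omega)
  rw [Q_eq q t (by omega) (by omega) (by simp; decide) hs, show 3 - 2 = 1 from rfl,
    show 3 * k + 2 - (2 * k + 1) = k + 1 by omega, Q_one_eq_D hM, Q_two k hM]
  refine LinearMap.ext fun F => (inv_smul_eq_iff₀ hM).mpr ?_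
  have := D_commutator_N_two q t k F
  exact_mod_cast this

theorem Q_four (hM : (1 - t) * (1 - q) ≠ 0) : Q q t 4 (4 * k + 1) = N q t 4 (4 * k + 1) := by
  have hs : split 4 (4 * k + 1) = (1, k) := by
    rcases Nat.eq_zero_or_pos k with rfl | hk
    · simp [split]
    · exact split_eq le_rfl (by omega) (by omega) (by omega)
  rw [Q_eq q t (by omega) (by omega) (by simp) hs, show 4 - 1 = 3 from rfl,
    show 4 * k + 1 - k = 3 * k + 1 by omega, Q_one_eq_D hM, Q_three k hM]
  exact LinearMap.ext fun F => (inv_smul_eq_iff₀ hM).mpr (N_three_commutator_D q t k F)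

theorem Q_four_inv (hM : (1 - t) * (1 - q) ≠ 0) :
    Q q t 4 (4 * k + 3) = N q t 4 (4 * k + 3) := by
  have hs : split 4 (4 * k + 3) = (3, 3 * k + 2) :=
    split_eq (by omega) (by omega) (by omega) (by omega)
  rw [Q_eq q t (by omega) (by omega) (by simp; decide) hs, show 4 - 3 = 1 from rfl,
    show 4 * k + 3 - (3 * k + 2) = k + 1 by omega, Q_one_eq_D hM, Q_three_inv k hM]
  refine LinearMap.ext fun F => (inv_smul_eq_iff₀ hM).mpr ?_
  have := D_commutator_N_three q t k F
  exact_mod_cast this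

/-- The bound `m ≤ 4` enters because the units modulo `m` are then only `±1`; modulo `5` the residue
`2` would already escape both families. -/
theorem Q_eq_N (hM : (1 - t) * (1 - q) ≠ 0) {m n : ℕ} (hm : 1 ≤ m) (hm4 : m ≤ 4) (hn : 1 ≤ n)
    (hmn : m.Coprime n) : Q q t m n = N q t m n := by
  have hmod := Nat.div_add_mod n m
  have hlt := Nat.mod_lt n hm
  have hg : Nat.gcd (n % m) m = 1 := by rw [← Nat.gcd_rec]; exact hmn
  generalize n / m = k at hmod
  generalize n % m = r at *
  subst hmod
  interval_cases m
  · rw [Q_one_eq_D hM, N_one_eq_D]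
  · interval_cases r
    · simp at hg
    · exact Q_two k hM
  · interval_cases r
    · simp at hg
    · exact Q_three k hM
    · exact Q_three_inv k hM
  · interval_cases r
    · simp at hg
    · exact Q_four k hM
    · simp at hg
    · exact Q_four_inv k hM

end MainTheorem

/-- An indeterminate has constant coefficient `0`, hence differs from `1`, also in the fraction
field. -/
theorem one_sub_tVar_mul_one_sub_qVar_ne_zero : (1 - tVar) * (1 - qVar) ≠ 0 := by
  have h : ∀ i : Fin 2, (1 : Qqt) -
      algebraMap (MvPolynomial (Fin 2) ℚ) Qqt (MvPolynomial.X i) ≠ 0 := by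
    intro i hi
    rw [sub_eq_zero, ← map_one (algebraMap (MvPolynomial (Fin 2) ℚ) Qqt)] at hi
    have h1 := congrArg MvPolynomial.constantCoeff
      (IsFractionRing.injective (MvPolynomial (Fin 2) ℚ) Qqt hi)
    simp at h1
  exact mul_ne_zero (h 1) (h 0)

end SymFun

end

theorem theorem3p2 (m n : ℕ) (hm : 1 ≤ m) (hm4 : m ≤ 4) (hn : 1 ≤ n) (hmn : Nat.Coprime m n) :
    SymFun.Q SymFun.qVar SymFun.tVar m n = SymFun.N SymFun.qVar SymFun.tVar m n :=
  SymFun.Q_eq_N SymFun.one_sub_tVar_mul_one_sub_qVar_ne_zero hm hm4 hn hmn
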